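/- **Estimation and prediction bounds with full data.** Consider the multi-response regression model $Y = XC^* + E$ with a fixed design $X\in\mathbb R^{n\times p}$ whose columns have $\ell_2$-norm $\sqrt n$, with $Y\in\mathbb R^{n\times q}$ fully observed, and with $C^*=\sum_{k=1}^{r^*} C_k^*$, $C_k^*=d_k^*u_k^*v_k^{*\mathrm T}$, i.e. $C^*=U^*D^*V^{*\mathrm T}$, where $D^*=\mathrm{diag}(d_1^*,\dots,d_{r^*}^*)$, $d_1^*\ge\dots\ge d_{r^*}^*>0$, and $(n^{-1/2}XU^*)^{\mathrm T}(n^{-1/2}XU^*)=V^{*\mathrm T}V^*=I_{r^*}$. *Assumptions.* 1. The entries $e_{ij}$ of $E$ are independent with $\mathbb E e_{ij}=0$, $\mathrm{Var}(e_{ij})=\sigma^2>0$, and sub-Gaussian: $\mathbb E e^{te_{ij}}\le e^{\kappa\sigma^2t^2/2}$ for all $t\in\mathbb R$. 2. For some $\gamma_d>0$, $q^{-1/2}(d_k^*-d_{k+1}^*)\ge\gamma_d$ for all $1\le k\le r^*$, where $d_{r^*+1}^*=0$; and $d_k^*\le b\sqrt q$ for $1\le k\le r^*$. 3. (Restricted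 eigenvalues.) For some sparsity level $s$ and some $\rho_l>0$, $$\inf\left\{\frac{\|X\delta\|_2^2}{n\,\max(\|\delta_J\|_2^2,\ \|\delta^{(1)}_{J^c}\|_2^2)}:\ \delta\neq0,\ |J|\le s,\ \|\delta_{J^c}\|_1\le3\|\delta_J\|_1\right\}\ge\rho_l,$$ where $\delta^{(1)}_{J^c}$ consists of the $s$ components of $\delta_{J^c}$ that are largest in magnitude. Moreover $s\ge\max_{1\le k\le r^*}s_k$, where $s_k=\|u_k^*\|_0$ is the number of non-zero entries of $u_k^*$. *Estimators.* Let $r\ge r^*$. Let $(\widetilde D,\widetilde Z,\widetilde V)$ be any minimizer of $(nq)^{-1}\|Y-ZDV^{\mathrm T}\|_F^2$ over $Z\in\mathbb R^{n\times r}$, $V\in\mathbb R^{q\times r}$ and diagonal $D\in\mathbb R^{r\times r}$ with $Z^{\mathrm T}Z=V^{\mathrm T}V=I_r$, where the diagonal entries $\widetilde d_1\ge\dots\ge\widetilde d_r\ge0$ of $\widetilde D$ are in descending order. Put $\widehat d_k=n^{-1/2}\widetilde d_k$, $\widehat v_k=\widetilde v_k$, let $\widehat u_k$ be any minimizer over $u\in\mathbb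 R^p$ of $n^{-1}\|\sqrt n\,\widetilde z_k-Xu\|_2^2+\lambda_k\|u\|_1$, and put $\widehat C_k=\widehat d_k\widehat u_k\widehat v_k^{\mathrm T}$. Let $\widetilde B_n=\sigma(n^{-1/2}+q^{-1/2})$ and $\lambda_k=4\tilde c\,\gamma_d^{-1}\widetilde B_n$. *Claim.* There is a constant $c_0>0$ depending only on $\kappa$ and $b$ such that for every $\tilde c\ge c_0$ there is a constant $K>0$ depending only on $\kappa$, $b$ and $\tilde c$ with the following property. With probability at least $1-2e^{-(\sqrt n+\sqrt q)^2}$, for every choice of the above minimizers and all $k=1,\dots,r^*$ simultaneously, after replacing $(\widehat u_k,\widehat v_k)$ by $(-\widehat u_k,-\widehat v_k)$ if necessary (singular vectors are determined only up to a common sign, which does not affect $\widehat C_k$), $$\|\widehat u_k-u_k^*\|_2\le K(\gamma_d\rho_l)^{-1}\sqrt{s_k}\,\widetilde B_n,\qquad \|\widehat v_k-v_k^*\|_2\le K\gamma_d^{-1}\widetilde B_n,$$ $$q^{-1/2}|\widehat d_k-d_k^*|\le K\widetilde B_n,\qquad q^{-1/2}\|\widehat C_k-C_k^*\|_F\le K(\gamma_d\rho_l)^{-1}\sqrt{s_k}\,\widetilde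 B_n,$$ $$\frac{\|X(\widehat u_k-u_k^*)\|_2}{\sqrt n}\le K\frac{\sqrt{s_k}\,\widetilde B_n}{\gamma_d\sqrt{\rho_l}},\qquad \frac{\|X(\widehat C_k-C_k^*)\|_F}{\sqrt{nq}}\le K\frac{\sqrt{s_k}\,\widetilde B_n}{\gamma_d\sqrt{\rho_l}}.$$ -/

import Mathlib

open MeasureTheory ProbabilityTheory
open scoped NNReal Matrix

namespace PEER

noncomputable section

/-- The Euclidean norm of a vector. -/
def l2norm {p : ℕ} (v : Fin p → ℝ) : ℝ := ‖WithLp.toLp 2 v‖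

/-- The `ℓ₁` norm of a vector. -/
def l1norm {p : ℕ} (v : Fin p → ℝ) : ℝ := ∑ j, |v j|

/-- The number of non-zero entries of a vector. -/
def l0norm {p : ℕ} (v : Fin p → ℝ) : ℕ := (Finset.univ.filter fun j => v j ≠ 0).card

section
open scoped Matrix.Norms.Frobenius

/-- The Frobenius norm of a matrix. -/
def frobNorm {m n : ℕ} (A : Matrix (Fin m) (Fin n) ℝ) : ℝ := ‖A‖

end

/-- Every column of the design matrix has Euclidean norm `√n`. -/
def ColumnsNormalized {n p : ℕ} (X : Matrix (Fin n) (Fin p) ℝ) : Prop :=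
  ∀ j, l2norm (X.col j) = √(n : ℝ)

/-- The decomposition `C = U D Vᵀ` of the coefficient matrix into `r` orthogonal latent factors:
`(n^{-1/2} X U)ᵀ (n^{-1/2} X U) = Vᵀ V = I_r` and `D = diag d` with `d₁ ≥ ⋯ ≥ d_r > 0`.
(These constraints force `rank C = rank (X C) = r`.) -/
structure IsLatentFactorDecomposition {n p q r : ℕ} (X : Matrix (Fin n) (Fin p) ℝ)
    (C : Matrix (Fin p) (Fin q) ℝ) (U : Matrix (Fin p) (Fin r) ℝ) (d : Fin r → ℝ)
    (V : Matrix (Fin q) (Fin r) ℝ) : Prop where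
  eq_mul : C = U * Matrix.diagonal d * Vᵀ
  left_orthonormal :
    (((√(n : ℝ))⁻¹ • (X * U))ᵀ * ((√(n : ℝ))⁻¹ • (X * U)) : Matrix (Fin r) (Fin r) ℝ) = 1
  right_orthonormal : Vᵀ * V = 1
  antitone : Antitone d
  pos : ∀ k, 0 < d k

/-- The `k`-th rank-one layer `d u vᵀ`. -/
def layer {p q : ℕ} (d : ℝ) (u : Fin p → ℝ) (v : Fin q → ℝ) : Matrix (Fin p) (Fin q) ℝ :=
  d • Matrix.vecMulVec u v

/-- The entries `e_{ij}` are independent, centred, of variance `σ²`, and sub-Gaussian with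
variance proxy `κ σ²`, i.e. `𝔼 exp (t e_{ij}) ≤ exp (κ σ² t² / 2)` for all real `t`. -/
structure ErrorCondition {n q : ℕ} {Ω : Type*} [MeasurableSpace Ω] (μ : Measure Ω)
    (E : Fin n → Fin q → Ω → ℝ) (σ : ℝ) (κ : ℝ≥0) : Prop where
  measurable : ∀ i j, Measurable (E i j)
  indep : iIndepFun (fun ij : Fin n × Fin q => E ij.1 ij.2) μ
  mean_zero : ∀ i j, ∫ ω, E i j ω ∂μ = 0
  variance_eq : ∀ i j, variance (E i j) μ = σ ^ 2
  subgaussian : ∀ i j, HasSubgaussianMGF (E i j) (κ * Real.toNNReal σ ^ 2) μ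

/-- The singular value following the `k`-th one, with the convention `d_{r+1} = 0`. -/
def nextValue {r : ℕ} (d : Fin r → ℝ) (k : Fin r) : ℝ :=
  if h : (k : ℕ) + 1 < r then d ⟨(k : ℕ) + 1, h⟩ else 0

/-- The singular values are separated, `q^{-1/2} (d_k - d_{k+1}) ≥ γ` for `1 ≤ k ≤ r` with
`d_{r+1} = 0`, and `d_k ≤ b √q`. -/
structure SingularValueCondition (q : ℕ) {r : ℕ} (d : Fin r → ℝ) (γ b : ℝ) : Prop where
  gap : ∀ k, γ ≤ (d k - nextValue d k) / √(q : ℝ)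
  bound : ∀ k, d k ≤ b * √(q : ℝ)

/-- `T` is a set of positions of the `s` largest components in magnitude of `δ_{Jᶜ}`
(all of `Jᶜ` if it has fewer than `s` elements). -/
def IsLargestOutside {p : ℕ} (s : ℕ) (δ : Fin p → ℝ) (J T : Finset (Fin p)) : Prop :=
  T ⊆ Jᶜ ∧ T.card = min s Jᶜ.card ∧ ∀ i ∈ T, ∀ j ∈ Jᶜ \ T, |δ j| ≤ |δ i|

/-- The restricted eigenvalue condition with sparsity level `s` and constant `ρ`. For `δ ≠ 0`
in the cone the denominator is positive. -/
def RestrictedEigenvalue {n p : ℕ} (X : Matrix (Fin n) (Fin p) ℝ) (s : ℕ) (ρ : ℝ) : Prop :=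
  ∀ (δ : Fin p → ℝ) (J T : Finset (Fin p)), δ ≠ 0 → J.card ≤ s →
    ∑ j ∈ Jᶜ, |δ j| ≤ 3 * ∑ j ∈ J, |δ j| → IsLargestOutside s δ J T →
    ρ ≤ l2norm (X *ᵥ δ) ^ 2 / (n * max (∑ j ∈ J, δ j ^ 2) (∑ j ∈ T, δ j ^ 2))

/-- First step with fully observed responses: `(Z, D, V)` with `D = diag d` minimizes
`(nq)⁻¹ ‖Y - Z D Vᵀ‖_F²` subject to `Zᵀ Z = Vᵀ V = I_r`, the entries of `d` being singular
values (non-negative) in descending order. -/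
structure IsFirstStep {n q r : ℕ} (Y : Matrix (Fin n) (Fin q) ℝ)
    (Z : Matrix (Fin n) (Fin r) ℝ) (d : Fin r → ℝ) (V : Matrix (Fin q) (Fin r) ℝ) : Prop where
  left_orthonormal : Zᵀ * Z = 1
  right_orthonormal : Vᵀ * V = 1
  nonneg : ∀ k, 0 ≤ d k
  antitone : Antitone d
  minimal : ∀ (Z' : Matrix (Fin n) (Fin r) ℝ) (d' : Fin r → ℝ) (V' : Matrix (Fin q) (Fin r) ℝ),
    Z'ᵀ * Z' = 1 → V'ᵀ * V' = 1 →
    ((n : ℝ) * q)⁻¹ * frobNorm (Y - Z * Matrix.diagonal d * Vᵀ) ^ 2 ≤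
      ((n : ℝ) * q)⁻¹ * frobNorm (Y - Z' * Matrix.diagonal d' * V'ᵀ) ^ 2

/-- `u` is a solution of the Lasso problem
`min_w n⁻¹ ‖√n z - X w‖₂² + lam ‖w‖₁`. -/
def IsLasso {n p : ℕ} (X : Matrix (Fin n) (Fin p) ℝ) (z : Fin n → ℝ) (lam : ℝ)
    (u : Fin p → ℝ) : Prop :=
  ∀ w : Fin p → ℝ,
    (n : ℝ)⁻¹ * l2norm (√(n : ℝ) • z - X *ᵥ u) ^ 2 + lam * l1norm u ≤
      (n : ℝ)⁻¹ * l2norm (√(n : ℝ) • z - X *ᵥ w) ^ 2 + lam * l1norm w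

/-- `(d, U, V)` are PEER estimates of the singular values and of the left and right singular
vectors computed from fully observed responses `Y` with initial rank `r` and regularization
parameters `lam`: for some first-step solution `(Z, D', V)`, `d = n^{-1/2} D'` and the `k`-th
column of `U` is a Lasso solution with response `√n z_k`. -/
def IsPEER {n p q r : ℕ} (X : Matrix (Fin n) (Fin p) ℝ) (Y : Matrix (Fin n) (Fin q) ℝ)
    (lam : Fin r → ℝ) (d : Fin r → ℝ) (U : Matrix (Fin p) (Fin r) ℝ)
    (V : Matrix (Fin q) (Fin r) ℝ) : Prop :=
  ∃ (Z : Matrix (Fin n) (Fin r) ℝ) (d' : Fin r → ℝ), IsFirstStep Y Z d' V ∧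
    (∀ k, d k = (√(n : ℝ))⁻¹ * d' k) ∧ ∀ k, IsLasso X (Z.col k) (lam k) (U.col k)

/-- The rate `σ (n^{-1/2} + q^{-1/2})`. -/
def rate (n q : ℕ) (σ : ℝ) : ℝ := σ * (1 / √(n : ℝ) + 1 / √(q : ℝ))

end

end PEER

/-! Randomness enters only through the operator norm of the noise. A net argument and a union bound
give `‖E‖ ≤ 12 √(κ+1) σ (√n + √q) = a √(nq) B`, where `B` is the rate and `a = 12 √(κ+1)`, outside
an event of probability at most `exp (-(√n + √q)²)` (`ErrorCondition.exists_event`). The good event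
concerns the noise alone, so on it everything else is deterministic and applies to all minimizers
and all `k` at once.

By an Eckart–Young argument any first-step minimizer consists of leading singular triples of `Y`
(`IsFirstStep.isTruncatedSVD`). The matrix `X C` has singular values `√n d_k`, left vectors
`n^{-1/2} X u_k` and right vectors `v_k`, and these values are separated by `γ √(nq)`. Weyl's
inequality therefore moves `d_k` by at most `a √q B`, and a Wedin-type bound moves the singular
vectors by at most `4 a B / γ`, up to a common sign (`IsFirstStep.error_bounds`).

The Lasso step is then a regression of `√n z_k = X u_k + √n w` with a deterministic error `‖w‖₂ ≤ 4
a B / γ`. Cauchy–Schwarz against columns of norm `√n` bounds the correlation of `w` with the design,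
so for `c ≥ 4 a` the penalty dominates it. The usual cone and restricted eigenvalue argument gives
the bounds for `u_k` (`IsLasso.error_bounds`).

For the layers, `d u vᵀ` is telescoped into three differences. The delicate point is that `‖û_k‖₂`
has no bound free of `ρ`. It always appears multiplied by `B`, and this product is controlled by the
triangle inequality if `B ≤ γ` and by the size of the penalty if `B > γ` (`IsPEER.error_bounds`). -/

namespace PEER

open scoped RealInnerProductSpace

/-! ### Perturbation of singular values and singular vectors. -/

section SingularValueDecomposition

variable {F G : Type*} [NormedAddCommGroup F] [InnerProductSpace ℝ F] [FiniteDimensional ℝ F]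
  [NormedAddCommGroup G] [InnerProductSpace ℝ G] [FiniteDimensional ℝ G]

/-- `T` maps the orthonormal family `v` to `m • u`, its adjoint maps the orthonormal family `u` to
`m • v`, and on the orthogonal complement of `v` it is bounded by the smallest `m k`. -/
structure IsTruncatedSVD {r : ℕ} (T : G →ₗ[ℝ] F) (u : Fin r → F) (v : Fin r → G)
    (m : Fin r → ℝ) : Prop where
  left : Orthonormal ℝ u
  right : Orthonormal ℝ v
  nonneg : ∀ k, 0 ≤ m k
  antitone : Antitone m
  map : ∀ k, T (v k) = m k • u k
  map_adjoint : ∀ k, T.adjoint (u k) = m k • v k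
  rest : ∀ x, (∀ k, ⟪v k, x⟫ = 0) → ∀ k, ‖T x‖ ≤ m k * ‖x‖

theorem norm_sq_eq_sum_add {E : Type*} [NormedAddCommGroup E] [InnerProductSpace ℝ E] {r : ℕ}
    {v : Fin r → E} (hv : Orthonormal ℝ v) (c : Fin r → ℝ) (w : E) (hw : ∀ k, ⟪v k, w⟫ = 0) :
    ‖∑ k, c k • v k + w‖ ^ 2 = ∑ k, c k ^ 2 + ‖w‖ ^ 2 := by
  have h : ⟪∑ k, c k • v k, w⟫ = 0 := by
    rw [sum_inner]
    exact Finset.sum_eq_zero fun k _ => by rw [inner_smul_left, hw k, mul_zero]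
  have h2 : ‖∑ k, c k • v k‖ ^ 2 = ∑ k, c k ^ 2 := by
    rw [← real_inner_self_eq_norm_sq, hv.inner_sum]
    simp [sq]
  rw [norm_add_sq_real, h, h2]
  ring

theorem inner_sub_sum_eq_zero {E : Type*} [NormedAddCommGroup E] [InnerProductSpace ℝ E] {r : ℕ}
    {v : Fin r → E} (hv : Orthonormal ℝ v) (x : E) (k : Fin r) :
    ⟪v k, x - ∑ j, ⟪v j, x⟫ • v j⟫ = 0 := by
  rw [inner_sub_right, hv.inner_right_fintype]
  simp

theorem norm_sq_eq_sum_inner_sq_add {E : Type*} [NormedAddCommGroup E] [InnerProductSpace ℝ E]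
    {r : ℕ} {v : Fin r → E} (hv : Orthonormal ℝ v) (x : E) :
    ‖x‖ ^ 2 = ∑ j, ⟪v j, x⟫ ^ 2 + ‖x - ∑ j, ⟪v j, x⟫ • v j‖ ^ 2 := by
  rw [← norm_sq_eq_sum_add hv _ _ (inner_sub_sum_eq_zero hv x)]
  simp

namespace IsTruncatedSVD

variable {r : ℕ} {T : G →ₗ[ℝ] F} {u : Fin r → F} {v : Fin r → G} {m : Fin r → ℝ}

/-- Upper half of the min-max principle. On the span of `v` the map is diagonal with entries at most
`m k` from index `k` on. The part of `x` orthogonal to `v` is sent orthogonally to `u`, because the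
adjoint maps `u j` into the line of `v j`, so the two contributions add as squares. -/
theorem norm_map_le (h : IsTruncatedSVD T u v m) (k : Fin r) (x : G)
    (hx : ∀ j, j < k → ⟪v j, x⟫ = 0) : ‖T x‖ ≤ m k * ‖x‖ := by
  set w := x - ∑ j, ⟪v j, x⟫ • v j with hw
  have hvw := inner_sub_sum_eq_zero h.right x
  have hx2 := norm_sq_eq_sum_inner_sq_add h.right x
  have hT : T x = ∑ j, (m j * ⟪v j, x⟫) • u j + T w := by
    have : x = ∑ j, ⟪v j, x⟫ • v j + w := by simp [hw]
    conv_lhs => rw [this]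
    simp [h.map, smul_smul, mul_comm]
  have hTw : ∀ j, ⟪u j, T w⟫ = 0 := fun j => by
    rw [← LinearMap.adjoint_inner_left, h.map_adjoint, inner_smul_left, hvw, mul_zero]
  have hT2 := norm_sq_eq_sum_add h.left (fun j => m j * ⟪v j, x⟫) (T w) hTw
  rw [← hT] at hT2
  have hr := h.rest w hvw k
  refine abs_le_of_sq_le_sq' ?_ (mul_nonneg (h.nonneg k) (norm_nonneg _)) |>.2
  rw [hT2, mul_pow, hx2, mul_add, Finset.mul_sum]
  refine add_le_add (Finset.sum_le_sum fun j _ => ?_) ?_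
  · rcases lt_or_ge j k with hj | hj
    · simp [hx j hj]
    · rw [mul_pow]
      exact mul_le_mul_of_nonneg_right
        (pow_le_pow_left₀ (h.nonneg j) (h.antitone hj) 2) (sq_nonneg _)
  · rw [← mul_pow]
    exact pow_le_pow_left₀ (norm_nonneg _) hr 2

theorem le_norm_map (h : IsTruncatedSVD T u v m) (k : Fin r) (c : Fin r → ℝ)
    (hc : ∀ j, k < j → c j = 0) : m k * ‖∑ j, c j • v j‖ ≤ ‖T (∑ j, c j • v j)‖ := by
  have h1 := norm_sq_eq_sum_add h.right c 0 (by simp)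
  have h2 := norm_sq_eq_sum_add h.left (fun j => m j * c j) 0 (by simp)
  have hT : T (∑ j, c j • v j) = ∑ j, (m j * c j) • u j := by
    simp [h.map, smul_smul, mul_comm]
  simp only [add_zero, norm_zero, ne_eq, OfNat.ofNat_ne_zero, not_false_eq_true, zero_pow] at h1 h2
  refine abs_le_of_sq_le_sq' ?_ (norm_nonneg _) |>.2
  rw [hT, h2, mul_pow, h1, Finset.mul_sum]
  refine Finset.sum_le_sum fun j _ => ?_
  rcases lt_or_ge k j with hj | hj
  · simp [hc j hj]
  · rw [mul_pow]
    exact mul_le_mul_of_nonneg_right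
      (pow_le_pow_left₀ (h.nonneg k) (h.antitone hj) 2) (sq_nonneg _)

/-- Weyl's inequality for singular values. -/
theorem le_add_of_norm_sub_le {r' : ℕ} {T' : G →ₗ[ℝ] F} {u' : Fin r' → F} {v' : Fin r' → G}
    {m' : Fin r' → ℝ} (h : IsTruncatedSVD T u v m) (h' : IsTruncatedSVD T' u' v' m') {η : ℝ}
    (hη : ∀ x, ‖T x - T' x‖ ≤ η * ‖x‖) (k : Fin r) (k' : Fin r') (hk : (k : ℕ) = k') :
    m k ≤ m' k' + η := by
  -- Indices start at `0`: `L` parametrises the span of `v 0, …, v k` by `k + 1` coefficients, while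
  -- `P` imposes only the `k` conditions of orthogonality to `v' 0, …, v' (k - 1)`. A non-zero
  -- common vector exists; `T` stretches it by at least `m k` and `T'` by at most `m' k'`.
  let L : (Fin (k + 1) → ℝ) →ₗ[ℝ] G :=
    ∑ i : Fin (k + 1), (LinearMap.proj i).smulRight (v ⟨i, by omega⟩)
  let P : (Fin (k + 1) → ℝ) →ₗ[ℝ] (Fin k → ℝ) :=
    LinearMap.pi fun i => (innerₛₗ ℝ (v' ⟨i, by omega⟩)).comp L
  obtain ⟨c, hc, hc0⟩ := (Submodule.ne_bot_iff _).1
    (LinearMap.ker_ne_bot_of_finrank_lt (f := P) (by simp))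
  let C : Fin r → ℝ := fun j => if hj : (j : ℕ) < k + 1 then c ⟨j, hj⟩ else 0
  have hC : ∀ i : Fin (k + 1), C ⟨i, by omega⟩ = c i := fun i => dif_pos i.isLt
  have hC0 : ∀ j : Fin r, ¬ (j : ℕ) < k + 1 → C j = 0 := fun j hj => dif_neg hj
  have hL : L c = ∑ j, C j • v j := by
    have h1 : L c = ∑ i : Fin (k + 1), c i • v ⟨i, by omega⟩ := by simp [L]
    rw [h1]
    refine Finset.sum_bij_ne_zero (fun i _ _ => ⟨i, by omega⟩) (by simp) ?_ ?_ ?_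
    · intro a _ _ b _ _ hab
      simpa [Fin.ext_iff] using hab
    · intro j _ hj
      by_cases hjk : (j : ℕ) < k + 1
      · exact ⟨⟨j, hjk⟩, Finset.mem_univ _, by rw [← hC]; exact hj, rfl⟩
      · rw [hC0 j hjk, zero_smul] at hj
        exact absurd rfl hj
    · intro i _ _
      rw [hC]
  set x := L c with hx
  have hxne : 0 < ‖x‖ := by
    rw [norm_pos_iff]
    intro hx0
    apply hc0
    have hli := h.right.linearIndependent
    rw [Fintype.linearIndependent_iff] at hli
    have := hli C (by rw [← hL, hx0])
    ext i
    rw [← hC i]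
    exact this ⟨i, by omega⟩
  have h1 : m k * ‖x‖ ≤ ‖T x‖ := by
    rw [hL]
    refine h.le_norm_map k C fun j hj => ?_
    have : (k : ℕ) < j := hj
    exact hC0 j (by omega)
  have h2 : ‖T' x‖ ≤ m' k' * ‖x‖ := by
    refine h'.norm_map_le k' x fun j hj => ?_
    have hj' : (j : ℕ) < k := by rw [hk]; exact hj
    have := congrFun hc ⟨j, hj'⟩
    simpa [P] using this
  have h3 := norm_le_norm_add_norm_sub' (T x) (T' x)
  have h4 := hη x
  have : m k * ‖x‖ ≤ (m' k' + η) * ‖x‖ := by linarith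
  exact le_of_mul_le_mul_right this hxne

theorem adjoint (h : IsTruncatedSVD T u v m)
    (hT : ∀ y, (∀ k, ⟪u k, y⟫ = 0) → T.adjoint y = 0) : IsTruncatedSVD T.adjoint v u m where
  left := h.right
  right := h.left
  nonneg := h.nonneg
  antitone := h.antitone
  map := h.map_adjoint
  map_adjoint k := by rw [LinearMap.adjoint_adjoint, h.map]
  rest y hy k := by
    rw [hT y hy, norm_zero]
    exact mul_nonneg (h.nonneg k) (norm_nonneg _)

/-- Since `T` kills the complement of `v`, the residual of an approximate singular pair splits into
its coordinates along `u` and the part of `z` outside their span. -/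
theorem norm_map_sub_smul_sq (h : IsTruncatedSVD T u v m)
    (hT : ∀ x, (∀ k, ⟪v k, x⟫ = 0) → T x = 0) (t : ℝ) (w : G) (z : F) :
    ‖T w - t • z‖ ^ 2 = ∑ j, (m j * ⟪v j, w⟫ - t * ⟪u j, z⟫) ^ 2 +
      t ^ 2 * ‖z - ∑ j, ⟪u j, z⟫ • u j‖ ^ 2 := by
  have h0 := hT _ (inner_sub_sum_eq_zero h.right w)
  rw [map_sub, sub_eq_zero] at h0
  have huz := inner_sub_sum_eq_zero h.left z
  have key := norm_sq_eq_sum_add h.left (fun j => m j * ⟪v j, w⟫ - t * ⟪u j, z⟫)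
    ((-t) • (z - ∑ j, ⟪u j, z⟫ • u j)) (fun k => by rw [inner_smul_right, huz, mul_zero])
  rw [norm_smul, mul_pow, Real.norm_eq_abs, sq_abs, neg_sq] at key
  rw [← key]
  congr 2
  have h1 : T (∑ j, ⟪v j, w⟫ • v j) = ∑ j, (m j * ⟪v j, w⟫) • u j := by
    simp [h.map, smul_smul, mul_comm]
  have h2 : ∑ j, (m j * ⟪v j, w⟫ - t * ⟪u j, z⟫) • u j =
      ∑ j, (m j * ⟪v j, w⟫) • u j - t • ∑ j, ⟪u j, z⟫ • u j := by
    simp [sub_smul, Finset.sum_sub_distrib, Finset.smul_sum, smul_smul]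
  rw [h0, h1, h2, neg_smul, smul_sub]
  abel

/-- This is a spectral gap estimate for the self-adjoint dilation `(w, z) ↦ (T* z, T w)`, in
coordinates `α` of `z` and `β` of `w`. The combinations `α j ± β j` diagonalise it with eigenvalues
`± m j`, and the residual masses `Z`, `W` have eigenvalue `0`. Every eigenvalue except `m k` is at
distance at least `g / 2` from `t`, so the residual controls all mass outside the direction `α k + β
k`. -/
theorem sq_mul_two_sub_le {r : ℕ} {m α β : Fin r → ℝ} {t g Z W : ℝ} (k : Fin r) (hm : ∀ j, 0 ≤ m j)
    (hg : 0 < g) (hgap : ∀ j, j ≠ k → g / 2 ≤ |m j - t|) (ht : g / 2 ≤ t) (hZ : 0 ≤ Z)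
    (hW : 0 ≤ W) (hα : ∑ j, α j ^ 2 + Z = 1) (hβ : ∑ j, β j ^ 2 + W = 1) :
    (g / 2) ^ 2 * (2 - (α k + β k) ^ 2 / 2) ≤
      ∑ j, (m j * β j - t * α j) ^ 2 + t ^ 2 * Z + (∑ j, (m j * α j - t * β j) ^ 2 + t ^ 2 * W) := by
  have ht2 : (g / 2) ^ 2 ≤ t ^ 2 := pow_le_pow_left₀ (by positivity) ht 2
  have hmt : ∀ j, (g / 2) ^ 2 ≤ (m j + t) ^ 2 := fun j =>
    pow_le_pow_left₀ (by positivity) (by linarith [hm j]) 2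
  have hterm : ∀ j, (g / 2) ^ 2 * (α j ^ 2 + β j ^ 2) -
      (if j = k then (g / 2) ^ 2 * ((α k + β k) ^ 2 / 2) else 0) ≤
      (m j * β j - t * α j) ^ 2 + (m j * α j - t * β j) ^ 2 := fun j => by
    have hid : (m j * β j - t * α j) ^ 2 + (m j * α j - t * β j) ^ 2 =
        ((m j - t) ^ 2 * (α j + β j) ^ 2 + (m j + t) ^ 2 * (α j - β j) ^ 2) / 2 := by ring
    rw [hid]
    have h1 := mul_le_mul_of_nonneg_right (hmt j) (sq_nonneg (α j - β j))
    split_ifs with hj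
    · subst hj
      have h2 : 0 ≤ (m j - t) ^ 2 * (α j + β j) ^ 2 := by positivity
      generalize (g / 2) ^ 2 = g' at *
      linarith
    · have h5 : (g / 2) ^ 2 ≤ (m j - t) ^ 2 := by
        rw [← sq_abs (m j - t)]
        exact pow_le_pow_left₀ (by positivity) (hgap j hj) 2
      have h2 := mul_le_mul_of_nonneg_right h5 (sq_nonneg (α j + β j))
      generalize (g / 2) ^ 2 = g' at *
      linarith
  have hsum := Finset.sum_le_sum fun j (_ : j ∈ Finset.univ) => hterm j
  rw [Finset.sum_sub_distrib, Finset.sum_ite_eq', if_pos (Finset.mem_univ _), ← Finset.mul_sum,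
    Finset.sum_add_distrib, Finset.sum_add_distrib, eq_sub_of_add_eq hα, eq_sub_of_add_eq hβ]
    at hsum
  have h1 := mul_le_mul_of_nonneg_right ht2 hZ
  have h2 := mul_le_mul_of_nonneg_right ht2 hW
  generalize (g / 2) ^ 2 = g' at *
  linarith

/-- If two inner products of unit vectors nearly add up to `2` in absolute value, then the vectors
are close, up to a common sign. -/
theorem exists_sign_of_inner_add_inner {E E' : Type*} [NormedAddCommGroup E]
    [InnerProductSpace ℝ E] [NormedAddCommGroup E'] [InnerProductSpace ℝ E'] {z u : E} {w v : E'}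
    (hz : ‖z‖ = 1) (hu : ‖u‖ = 1) (hw : ‖w‖ = 1) (hv : ‖v‖ = 1) {δ : ℝ} (hδ : 0 ≤ δ)
    (h : 2 * (2 - (⟪u, z⟫ + ⟪v, w⟫) ^ 2 / 2) ≤ δ ^ 2) :
    ∃ ε : ℝ, (ε = 1 ∨ ε = -1) ∧ ‖ε • z - u‖ ≤ δ ∧ ‖ε • w - v‖ ≤ δ := by
  have hα : |⟪u, z⟫| ≤ 1 := by
    have := abs_real_inner_le_norm u z
    rwa [hu, hz, one_mul] at this
  have hβ : |⟪v, w⟫| ≤ 1 := by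
    have := abs_real_inner_le_norm v w
    rwa [hv, hw, one_mul] at this
  obtain ⟨ε, hε, hεa⟩ : ∃ ε : ℝ, (ε = 1 ∨ ε = -1) ∧
      ε * (⟪u, z⟫ + ⟪v, w⟫) = |⟪u, z⟫ + ⟪v, w⟫| := by
    rcases abs_cases (⟪u, z⟫ + ⟪v, w⟫) with h1 | h1
    · exact ⟨1, Or.inl rfl, by rw [h1.1, one_mul]⟩
    · exact ⟨-1, Or.inr rfl, by rw [h1.1, neg_one_mul]⟩
  have hε2 : ε ^ 2 = 1 := by rcases hε with h1 | h1 <;> rw [h1] <;> norm_num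
  have dz : ‖ε • z - u‖ ^ 2 = 2 - 2 * (ε * ⟪u, z⟫) := by
    rw [norm_sub_sq_real, norm_smul, mul_pow, Real.norm_eq_abs, sq_abs, hε2, hz, hu,
      real_inner_smul_left, real_inner_comm]
    ring
  have dw : ‖ε • w - v‖ ^ 2 = 2 - 2 * (ε * ⟪v, w⟫) := by
    rw [norm_sub_sq_real, norm_smul, mul_pow, Real.norm_eq_abs, sq_abs, hε2, hw, hv,
      real_inner_smul_left, real_inner_comm]
    ring
  have htot : ‖ε • z - u‖ ^ 2 + ‖ε • w - v‖ ^ 2 ≤ δ ^ 2 := by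
    rw [← sq_abs] at h
    -- For `0 ≤ x ≤ 2` one has `4 - 2 x ≤ 4 - x ^ 2`, which is the form of the hypothesis.
    have habs : |⟪u, z⟫ + ⟪v, w⟫| ≤ 2 := (abs_add_le _ _).trans (by linarith)
    have h1 : ‖ε • z - u‖ ^ 2 + ‖ε • w - v‖ ^ 2 = 4 - 2 * |⟪u, z⟫ + ⟪v, w⟫| := by
      rw [dz, dw, ← hεa]
      ring
    rw [h1]
    have h0 := abs_nonneg (⟪u, z⟫ + ⟪v, w⟫)
    linarith [mul_nonneg h0 (sub_nonneg.2 habs)]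
  refine ⟨ε, hε, ?_, ?_⟩
  · refine abs_le_of_sq_le_sq' ?_ hδ |>.2
    linarith [sq_nonneg ‖ε • w - v‖]
  · refine abs_le_of_sq_le_sq' ?_ hδ |>.2
    linarith [sq_nonneg ‖ε • z - u‖]

/-- A version of Wedin's theorem: an approximate singular pair of `T` whose approximate singular
value is close to an isolated singular value `m k` is close to `(u k, v k)`, up to a common
sign. -/
theorem exists_sign_norm_sub_le (h : IsTruncatedSVD T u v m)
    (hT : ∀ x, (∀ k, ⟪v k, x⟫ = 0) → T x = 0)
    (hT' : ∀ y, (∀ k, ⟪u k, y⟫ = 0) → T.adjoint y = 0) (k : Fin r) {z : F} {w : G}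
    (hz : ‖z‖ = 1) (hw : ‖w‖ = 1) {t η g : ℝ} (hg : 0 < g)
    (hgap : ∀ j, j ≠ k → g ≤ |m j - m k|) (hgk : g ≤ m k) (ht : |t - m k| ≤ η)
    (he : ‖T w - t • z‖ ≤ η) (hf : ‖T.adjoint z - t • w‖ ≤ η) :
    ∃ ε : ℝ, (ε = 1 ∨ ε = -1) ∧ ‖ε • z - u k‖ ≤ 4 * η / g ∧ ‖ε • w - v k‖ ≤ 4 * η / g := by
  have hη : 0 ≤ η := (abs_nonneg _).trans ht
  have huk : ‖u k‖ = 1 := h.left.1 k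
  have hvk : ‖v k‖ = 1 := h.right.1 k
  -- If `g < 2 η`, the claimed bound exceeds `2`, the largest distance of two unit vectors.
  -- Otherwise moving from `m k` to `t` costs at most half of the gap.
  rcases lt_or_ge g (2 * η) with hgη | hgη
  · have h2 : (2 : ℝ) ≤ 4 * η / g := by
      rw [le_div_iff₀ hg]
      linarith
    refine ⟨1, Or.inl rfl, ?_, ?_⟩
    · rw [one_smul]
      linarith [norm_sub_le z (u k)]
    · rw [one_smul]
      linarith [norm_sub_le w (v k)]
  have z1 := norm_sq_eq_sum_inner_sq_add h.left z
  have w1 := norm_sq_eq_sum_inner_sq_add h.right w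
  rw [hz, one_pow] at z1
  rw [hw, one_pow] at w1
  have e2 : ‖T w - t • z‖ ^ 2 ≤ η ^ 2 := pow_le_pow_left₀ (norm_nonneg _) he 2
  have f2 : ‖T.adjoint z - t • w‖ ^ 2 ≤ η ^ 2 := pow_le_pow_left₀ (norm_nonneg _) hf 2
  rw [h.norm_map_sub_smul_sq hT] at e2
  rw [(h.adjoint hT').norm_map_sub_smul_sq hT'] at f2
  have ht' := abs_le.1 ht
  have key := sq_mul_two_sub_le (t := t) k h.nonneg hg (fun j hj => by
    have := abs_sub_abs_le_abs_sub (m j - m k) (t - m k)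
    rw [sub_sub_sub_cancel_right] at this
    linarith [hgap j hj]) (by linarith) (sq_nonneg _) (sq_nonneg _) z1.symm w1.symm
  have hb := key.trans (add_le_add e2 f2)
  refine exists_sign_of_inner_add_inner hz huk hw hvk (by positivity) ?_
  rw [div_pow, le_div_iff₀ (by positivity)]
  linarith

end IsTruncatedSVD

end SingularValueDecomposition

/-! ### Maximizing orthonormal families are singular vectors. -/

theorem exists_cos_sin_sq (x y : ℝ) :
    ∃ φ : ℝ, (x * Real.cos φ + y * Real.sin φ) ^ 2 = x ^ 2 + y ^ 2 := by
  refine ⟨Complex.arg ⟨x, y⟩, ?_⟩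
  have h1 := Complex.norm_mul_cos_arg ⟨x, y⟩
  have h2 := Complex.norm_mul_sin_arg ⟨x, y⟩
  simp only at h1 h2
  set N := ‖(⟨x, y⟩ : ℂ)‖
  set φ := Complex.arg ⟨x, y⟩
  have h3 := Real.sin_sq_add_cos_sq φ
  rw [← h1, ← h2]
  linear_combination N ^ 2 * (Real.sin φ ^ 2 + Real.cos φ ^ 2) * h3

/-- If no pair of plane rotations increases the sum of the squares of the diagonal entries of a
`2 × 2` matrix, then the matrix is diagonal. -/
theorem eq_zero_of_rotation_le {a g h e : ℝ}
    (H : ∀ θ φ : ℝ,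
      (Real.cos θ * Real.cos φ * a + Real.cos θ * Real.sin φ * g + Real.sin θ * Real.cos φ * h +
        Real.sin θ * Real.sin φ * e) ^ 2 +
      (Real.sin θ * Real.sin φ * a - Real.sin θ * Real.cos φ * g - Real.cos θ * Real.sin φ * h +
        Real.cos θ * Real.cos φ * e) ^ 2 ≤ a ^ 2 + e ^ 2) : g = 0 := by
  obtain ⟨x, hx⟩ := exists_cos_sin_sq (a + e) (g - h)
  obtain ⟨y, hy⟩ := exists_cos_sin_sq (a - e) (g + h)
  -- With angles `θ`, `φ`, the sum of the two new diagonal entries depends only on `φ - θ` and their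
  -- difference only on `φ + θ`. Setting these to `x` and `y` maximizes both squares at once, and
  -- half their total is `a² + e² + g² + h²`.
  have hx' : x = (x + y) / 2 - (y - x) / 2 := by ring
  have hy' : y = (x + y) / 2 + (y - x) / 2 := by ring
  have H1 := H ((y - x) / 2) ((x + y) / 2)
  rw [hx', Real.cos_sub, Real.sin_sub] at hx
  rw [hy', Real.cos_add, Real.sin_add] at hy
  generalize Real.cos ((y - x) / 2) = c at *
  generalize Real.sin ((y - x) / 2) = s at *
  generalize Real.cos ((x + y) / 2) = c' at *
  generalize Real.sin ((x + y) / 2) = s' at *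
  have hid : (c * c' * a + c * s' * g + s * c' * h + s * s' * e) ^ 2 +
      (s * s' * a - s * c' * g - c * s' * h + c * c' * e) ^ 2 =
      (((a + e) * (c' * c + s' * s) + (g - h) * (s' * c - c' * s)) ^ 2 +
        ((a - e) * (c' * c - s' * s) + (g + h) * (s' * c + c' * s)) ^ 2) / 2 := by ring
  rw [hid, hx, hy] at H1
  have : g ^ 2 = 0 := le_antisymm (by linarith [sq_nonneg h]) (sq_nonneg g)
  simpa using this

theorem Orthonormal.update {E : Type*} [NormedAddCommGroup E] [InnerProductSpace ℝ E] {r : ℕ}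
    {z : Fin r → E} (hz : Orthonormal ℝ z) (k : Fin r) {y : E} (hy : ‖y‖ = 1)
    (hzy : ∀ j, j ≠ k → ⟪z j, y⟫ = 0) : Orthonormal ℝ (Function.update z k y) := by
  refine ⟨fun i => ?_, fun i j hij => ?_⟩
  · rcases eq_or_ne i k with rfl | hi
    · simpa using hy
    · simpa [hi] using hz.1 i
  · rcases eq_or_ne i k with rfl | hi
    · rw [Function.update_self, Function.update_of_ne hij.symm, real_inner_comm]
      exact hzy j hij.symm
    · rw [Function.update_of_ne hi]
      rcases eq_or_ne j k with rfl | hj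
      · rw [Function.update_self]
        exact hzy i hi
      · rw [Function.update_of_ne hj]
        exact hz.2 hij

/-- The family `z` with `z k` and `z l` rotated by the angle `θ`. -/
noncomputable def rotate {E : Type*} [AddCommGroup E] [Module ℝ E] {r : ℕ} (z : Fin r → E)
    (k l : Fin r) (θ : ℝ) (i : Fin r) : E :=
  if i = k then Real.cos θ • z k + Real.sin θ • z l
  else if i = l then Real.cos θ • z l - Real.sin θ • z k else z i

theorem rotate_left {E : Type*} [AddCommGroup E] [Module ℝ E] {r : ℕ} (z : Fin r → E)
    (k l : Fin r) (θ : ℝ) : rotate z k l θ k = Real.cos θ • z k + Real.sin θ • z l :=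
  if_pos rfl

theorem rotate_right {E : Type*} [AddCommGroup E] [Module ℝ E] {r : ℕ} (z : Fin r → E)
    {k l : Fin r} (h : k ≠ l) (θ : ℝ) :
    rotate z k l θ l = Real.cos θ • z l - Real.sin θ • z k := by
  rw [rotate, if_neg h.symm, if_pos rfl]

theorem rotate_of_ne {E : Type*} [AddCommGroup E] [Module ℝ E] {r : ℕ} (z : Fin r → E)
    {k l i : Fin r} (hk : i ≠ k) (hl : i ≠ l) (θ : ℝ) : rotate z k l θ i = z i := by
  rw [rotate, if_neg hk, if_neg hl]

theorem Orthonormal.rotate {E : Type*} [NormedAddCommGroup E] [InnerProductSpace ℝ E] {r : ℕ}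
    {z : Fin r → E} (hz : Orthonormal ℝ z) {k l : Fin r} (hkl : k ≠ l) (θ : ℝ) :
    Orthonormal ℝ (rotate z k l θ) := by
  have h1 : ∀ i, ⟪z i, z i⟫ = 1 := fun i => by simp [hz.1]
  have h0 : ∀ {i j}, i ≠ j → ⟪z i, z j⟫ = 0 := fun h => hz.2 h
  have hcs := Real.sin_sq_add_cos_sq θ
  have hdiag : ∀ i, ⟪PEER.rotate z k l θ i, PEER.rotate z k l θ i⟫ = 1 := fun i => by
    rcases eq_or_ne i k with rfl | hik
    · simp only [rotate_left, inner_add_left, inner_add_right, real_inner_smul_left,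
        real_inner_smul_right, h1, h0 hkl, h0 hkl.symm]
      linarith
    · rcases eq_or_ne i l with rfl | hil
      · simp only [rotate_right z hkl, inner_sub_left, inner_sub_right, real_inner_smul_left,
          real_inner_smul_right, h1, h0 hkl, h0 hkl.symm]
        linarith
      · rw [rotate_of_ne z hik hil, h1]
  refine ⟨fun i => ?_, fun i j hij => ?_⟩
  · have := hdiag i
    rw [real_inner_self_eq_norm_sq] at this
    exact (pow_eq_one_iff_of_nonneg (norm_nonneg _) two_ne_zero).1 this
  · change ⟪_, _⟫ = 0
    have hk : ∀ {i}, i ≠ k → ⟪PEER.rotate z k l θ k, PEER.rotate z k l θ i⟫ = 0 := fun {i} hik => by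
      rcases eq_or_ne i l with rfl | hil
      · simp only [rotate_left, rotate_right z hkl, inner_add_left, inner_sub_right,
          real_inner_smul_left, real_inner_smul_right, h1, h0 hkl, h0 hkl.symm]
        ring
      · simp only [rotate_left, rotate_of_ne z hik hil, inner_add_left, real_inner_smul_left,
          h0 hik.symm, h0 hil.symm, mul_zero, add_zero]
    have hl : ∀ {i}, i ≠ k → i ≠ l → ⟪PEER.rotate z k l θ l, PEER.rotate z k l θ i⟫ = 0 :=
      fun {i} hik hil => by
        simp only [rotate_right z hkl, rotate_of_ne z hik hil, inner_sub_left,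
          real_inner_smul_left, h0 hik.symm, h0 hil.symm, mul_zero, sub_zero]
    rcases eq_or_ne i k with rfl | hik
    · exact hk hij.symm
    rcases eq_or_ne j k with rfl | hjk
    · rw [real_inner_comm]
      exact hk hik
    rcases eq_or_ne i l with rfl | hil
    · exact hl hjk hij.symm
    rcases eq_or_ne j l with rfl | hjl
    · rw [real_inner_comm]
      exact hl hik hil
    rw [rotate_of_ne z hik hil, rotate_of_ne z hjk hjl, h0 hij]

section Maximiser

variable {F G : Type*} [NormedAddCommGroup F] [InnerProductSpace ℝ F]
  [NormedAddCommGroup G] [InnerProductSpace ℝ G]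
  {r : ℕ} {T : G →ₗ[ℝ] F} {z : Fin r → F} {v : Fin r → G}

theorem inner_sq_le_of_maximal
    (hmax : ∀ z' v', Orthonormal ℝ z' → Orthonormal ℝ v' →
      ∑ k : Fin r, ⟪z' k, T (v' k)⟫ ^ 2 ≤ ∑ k, ⟪z k, T (v k)⟫ ^ 2)
    (hz : Orthonormal ℝ z) (hv : Orthonormal ℝ v) (k : Fin r) {y : F} {x : G} (hy : ‖y‖ = 1)
    (hx : ‖x‖ = 1) (hzy : ∀ j, j ≠ k → ⟪z j, y⟫ = 0) (hvx : ∀ j, j ≠ k → ⟪v j, x⟫ = 0) :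
    ⟪y, T x⟫ ^ 2 ≤ ⟪z k, T (v k)⟫ ^ 2 := by
  have h := hmax _ _ (Orthonormal.update hz k hy hzy) (Orthonormal.update hv k hx hvx)
  rw [← Finset.add_sum_erase _ _ (Finset.mem_univ k),
    ← Finset.add_sum_erase Finset.univ (fun k => ⟪z k, T (v k)⟫ ^ 2) (Finset.mem_univ k)] at h
  simp only [Function.update_self] at h
  have h2 : ∑ i ∈ Finset.univ.erase k,
      ⟪Function.update z k y i, T (Function.update v k x i)⟫ ^ 2 =
      ∑ i ∈ Finset.univ.erase k, ⟪z i, T (v i)⟫ ^ 2 :=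
    Finset.sum_congr rfl fun i hi => by
      rw [Function.update_of_ne (Finset.ne_of_mem_erase hi),
        Function.update_of_ne (Finset.ne_of_mem_erase hi)]
  linarith

/-- Rotating both families in the planes of indices `k` and `l` changes only two summands, so
maximality reduces to the `2 × 2` case. -/
theorem inner_eq_zero_of_maximal
    (hmax : ∀ z' v', Orthonormal ℝ z' → Orthonormal ℝ v' →
      ∑ k : Fin r, ⟪z' k, T (v' k)⟫ ^ 2 ≤ ∑ k, ⟪z k, T (v k)⟫ ^ 2)
    (hz : Orthonormal ℝ z) (hv : Orthonormal ℝ v) {k l : Fin r} (hkl : k ≠ l) :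
    ⟪z k, T (v l)⟫ = 0 := by
  refine eq_zero_of_rotation_le (a := ⟪z k, T (v k)⟫) (h := ⟪z l, T (v k)⟫)
    (e := ⟪z l, T (v l)⟫) fun θ φ => ?_
  have h := hmax _ _ (Orthonormal.rotate hz hkl θ) (Orthonormal.rotate hv hkl φ)
  have hlk : l ∈ Finset.univ.erase k := by simp [hkl.symm]
  rw [← Finset.add_sum_erase _ _ (Finset.mem_univ k), ← Finset.add_sum_erase _ _ hlk,
    ← Finset.add_sum_erase Finset.univ (fun k => ⟪z k, T (v k)⟫ ^ 2) (Finset.mem_univ k),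
    ← Finset.add_sum_erase (Finset.univ.erase k) (fun k => ⟪z k, T (v k)⟫ ^ 2) hlk] at h
  have h2 : ∑ i ∈ (Finset.univ.erase k).erase l,
      ⟪rotate z k l θ i, T (rotate v k l φ i)⟫ ^ 2 =
      ∑ i ∈ (Finset.univ.erase k).erase l, ⟪z i, T (v i)⟫ ^ 2 :=
    Finset.sum_congr rfl fun i hi => by
      have hil := Finset.ne_of_mem_erase hi
      have hik := Finset.ne_of_mem_erase (Finset.mem_of_mem_erase hi)
      rw [rotate_of_ne z hik hil, rotate_of_ne v hik hil]
  rw [h2, ← add_assoc, ← add_assoc] at h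
  have h3 := le_of_add_le_add_right h
  simp only [rotate_left, rotate_right _ hkl, map_add, map_sub, map_smul, inner_add_left,
    inner_add_right, inner_sub_left, inner_sub_right, real_inner_smul_left,
    real_inner_smul_right] at h3
  refine le_trans (le_of_eq ?_) h3
  ring

/-- As the off-diagonal products vanish, the normalised `T (v k)` may replace `z k`. Maximality then
forces equality in Cauchy–Schwarz for `z k` and `T (v k)`. -/
theorem map_eq_smul_of_maximal
    (hmax : ∀ z' v', Orthonormal ℝ z' → Orthonormal ℝ v' →
      ∑ k : Fin r, ⟪z' k, T (v' k)⟫ ^ 2 ≤ ∑ k, ⟪z k, T (v k)⟫ ^ 2)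
    (hz : Orthonormal ℝ z) (hv : Orthonormal ℝ v) (k : Fin r) :
    T (v k) = ⟪z k, T (v k)⟫ • z k := by
  set w := T (v k) with hw
  set d := ⟪z k, w⟫ with hd
  rcases eq_or_ne w 0 with h0 | h0
  · simp [hd, h0]
  have hw0 : 0 < ‖w‖ := norm_pos_iff.2 h0
  have h1 := inner_sq_le_of_maximal hmax hz hv k (y := ‖w‖⁻¹ • w) (x := v k)
    (by rw [norm_smul, norm_inv, norm_norm, inv_mul_cancel₀ hw0.ne']) (hv.1 k)
    (fun j hj => by rw [inner_smul_right, inner_eq_zero_of_maximal hmax hz hv hj, mul_zero])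
    (fun j hj => hv.2 hj)
  rw [← hw, real_inner_smul_left, real_inner_self_eq_norm_sq, sq ‖w‖,
    inv_mul_cancel_left₀ hw0.ne', ← hd] at h1
  rw [← sub_eq_zero, ← norm_eq_zero, ← sq_eq_zero_iff]
  refine le_antisymm ?_ (sq_nonneg _)
  rw [norm_sub_sq_real, inner_smul_right, real_inner_comm, ← hd, norm_smul, hz.1, mul_one,
    Real.norm_eq_abs, sq_abs]
  linarith

/-- Orthonormal families maximizing `∑ k, ⟪z k, T (v k)⟫ ^ 2` are singular vectors. -/
theorem isTruncatedSVD_of_maximal [FiniteDimensional ℝ F] [FiniteDimensional ℝ G]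
    (hmax : ∀ z' v', Orthonormal ℝ z' → Orthonormal ℝ v' →
      ∑ k : Fin r, ⟪z' k, T (v' k)⟫ ^ 2 ≤ ∑ k, ⟪z k, T (v k)⟫ ^ 2)
    (hz : Orthonormal ℝ z) (hv : Orthonormal ℝ v) {d : Fin r → ℝ}
    (hd : ∀ k, ⟪z k, T (v k)⟫ = d k) (hd0 : ∀ k, 0 ≤ d k) (hda : Antitone d) :
    IsTruncatedSVD T z v d := by
  have hcomm : ∀ y x, ⟪x, T.adjoint y⟫ = ⟪y, T x⟫ := fun y x => by
    rw [LinearMap.adjoint_inner_right, real_inner_comm]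
  have hadj : ∀ k, T.adjoint (z k) = d k • v k := fun k => by
    -- The objective is unchanged when `T` is replaced by its adjoint and the two families are
    -- exchanged.
    have := map_eq_smul_of_maximal (T := T.adjoint) (z := v) (v := z)
      (fun v' z' hv' hz' => by simpa only [hcomm] using hmax z' v' hz' hv') hv hz k
    rwa [hcomm, hd] at this
  refine ⟨hz, hv, hd0, hda, fun k => ?_, hadj, fun x hx k => ?_⟩
  · rw [← hd]
    exact map_eq_smul_of_maximal hmax hz hv k
  · rcases eq_or_ne (T x) 0 with h0 | h0
    · rw [h0, norm_zero]
      exact mul_nonneg (hd0 k) (norm_nonneg _)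
    have hx0 : x ≠ 0 := fun h => h0 (by rw [h, map_zero])
    have hTx := norm_pos_iff.2 h0
    have hxp := norm_pos_iff.2 hx0
    -- As `x` is orthogonal to all `v j`, the adjoint relation makes `T x` orthogonal to all `z j`,
    -- so this normalised pair may replace the `k`-th one.
    have h1 := inner_sq_le_of_maximal hmax hz hv k (y := ‖T x‖⁻¹ • T x) (x := ‖x‖⁻¹ • x)
      (by rw [norm_smul, norm_inv, norm_norm, inv_mul_cancel₀ hTx.ne'])
      (by rw [norm_smul, norm_inv, norm_norm, inv_mul_cancel₀ hxp.ne'])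
      (fun j _ => by
        rw [inner_smul_right, ← LinearMap.adjoint_inner_left, hadj, real_inner_smul_left, hx,
          mul_zero, mul_zero])
      (fun j _ => by rw [inner_smul_right, hx, mul_zero])
    rw [hd, map_smul, real_inner_smul_left, real_inner_smul_right, real_inner_self_eq_norm_sq] at h1
    have h2 := (abs_le_of_sq_le_sq' h1 (hd0 k)).2
    have h3 : ‖T x‖⁻¹ * (‖x‖⁻¹ * ‖T x‖ ^ 2) = ‖T x‖ / ‖x‖ := by
      field_simp
    rwa [h3, div_le_iff₀ hxp] at h2

end Maximiser

/-! ### Nets of the unit ball and the operator norm of the noise. -/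

theorem exists_half_net (E : Type*) [NormedAddCommGroup E] [NormedSpace ℝ E]
    [FiniteDimensional ℝ E] : ∃ s : Finset E, s.card ≤ 5 ^ Module.finrank ℝ E ∧
      (∀ c ∈ s, ‖c‖ ≤ 1) ∧ ∀ x : E, ‖x‖ ≤ 1 → ∃ c ∈ s, ‖x - c‖ ≤ 1 / 2 := by
  classical
  let P : Finset E → Prop := fun s =>
    -- A `1`-separated set in the ball of radius `2` has at most `5 ^ dim` points. One of maximal
    -- cardinality is a `1`-net of that ball, and halving it yields the net sought.
    (∀ c ∈ s, ‖c‖ ≤ 2) ∧ ∀ c ∈ s, ∀ d ∈ s, c ≠ d → 1 ≤ ‖c - d‖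
  have hP : ∀ s, P s → s.card ≤ 5 ^ Module.finrank ℝ E := fun s hs =>
    Besicovitch.card_le_of_separated s hs.1 hs.2
  let N : Set ℕ := {n | ∃ s, P s ∧ s.card = n}
  have hbdd : BddAbove N := ⟨5 ^ Module.finrank ℝ E, by
    rintro n ⟨s, hs, rfl⟩
    exact hP s hs⟩
  obtain ⟨s, hs, hcard⟩ : sSup N ∈ N := Nat.sSup_mem ⟨0, ∅, by simp [P], by simp⟩ hbdd
  refine ⟨s.image fun c => (2⁻¹ : ℝ) • c, Finset.card_image_le.trans (hP s hs), ?_, ?_⟩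
  · intro c hc
    obtain ⟨c', hc', rfl⟩ := Finset.mem_image.1 hc
    have := hs.1 c' hc'
    rw [norm_smul]
    norm_num
    linarith
  · intro x hx
    obtain ⟨c, hc, hcx⟩ : ∃ c ∈ s, ‖(2 : ℝ) • x - c‖ < 1 := by
      by_contra! hno
      have hxs : (2 : ℝ) • x ∉ s := fun h => by
        have := hno _ h
        rw [sub_self, norm_zero] at this
        linarith
      have hins : P (insert ((2 : ℝ) • x) s) := by
        refine ⟨?_, ?_⟩
        · intro c hc
          rcases Finset.mem_insert.1 hc with rfl | hc
          · rw [norm_smul]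
            norm_num
            linarith
          · exact hs.1 c hc
        · intro c hc d hd hcd
          rcases Finset.mem_insert.1 hc with rfl | hc
          · rcases Finset.mem_insert.1 hd with rfl | hd
            · exact absurd rfl hcd
            · exact hno d hd
          · rcases Finset.mem_insert.1 hd with rfl | hd
            · rw [norm_sub_rev]
              exact hno c hc
            · exact hs.2 c hc d hd hcd
      have h1 : (insert ((2 : ℝ) • x) s).card ≤ sSup N := le_csSup hbdd ⟨_, hins, rfl⟩
      rw [Finset.card_insert_of_notMem hxs] at h1
      omega
    refine ⟨(2⁻¹ : ℝ) • c, Finset.mem_image_of_mem _ hc, ?_⟩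
    have h1 : x - (2⁻¹ : ℝ) • c = (2⁻¹ : ℝ) • ((2 : ℝ) • x - c) := by
      rw [smul_sub, smul_smul]
      norm_num
    rw [h1, norm_smul]
    norm_num
    linarith

/-- Approximating a unit vector from the net costs at most `‖L‖ / 2`, which is absorbed on the left.
-/
theorem norm_map_le_of_half_net {E F : Type*} [NormedAddCommGroup E] [NormedSpace ℝ E]
    [NormedAddCommGroup F] [NormedSpace ℝ F] (L : E →L[ℝ] F) {s : Finset E}
    (hs : ∀ x : E, ‖x‖ ≤ 1 → ∃ c ∈ s, ‖x - c‖ ≤ 1 / 2) {t : ℝ} (ht : 0 ≤ t)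
    (hL : ∀ c ∈ s, ‖L c‖ ≤ t) : ‖L‖ ≤ 2 * t := by
  have h : ‖L‖ ≤ t + ‖L‖ * (1 / 2) := by
    refine L.opNorm_le_of_unit_norm (by positivity) fun x hx => ?_
    obtain ⟨c, hc, hxc⟩ := hs x hx.le
    calc ‖L x‖ = ‖L c + L (x - c)‖ := by rw [map_sub]; congr 1; abel
      _ ≤ ‖L c‖ + ‖L (x - c)‖ := norm_add_le _ _
      _ ≤ t + ‖L‖ * (1 / 2) := add_le_add (hL c hc)
        ((L.le_opNorm _).trans (mul_le_mul_of_nonneg_left hxc (norm_nonneg _)))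
  linarith

theorem norm_le_of_half_net {F : Type*} [NormedAddCommGroup F] [InnerProductSpace ℝ F]
    {s : Finset F} (hs : ∀ x : F, ‖x‖ ≤ 1 → ∃ c ∈ s, ‖x - c‖ ≤ 1 / 2) {t : ℝ} {y : F}
    (hy : ∀ c ∈ s, ⟪c, y⟫ ≤ t) : ‖y‖ ≤ 2 * t := by
  rcases eq_or_ne y 0 with rfl | h0
  · obtain ⟨c, hc, -⟩ := hs 0 (by simp)
    have := hy c hc
    rw [inner_zero_right] at this
    rw [norm_zero]
    linarith
  have hp := norm_pos_iff.2 h0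
  obtain ⟨c, hc, hxc⟩ := hs (‖y‖⁻¹ • y) (by
    rw [norm_smul, norm_inv, norm_norm, inv_mul_cancel₀ hp.ne'])
  have h1 : ‖y‖ = ⟪c, y⟫ + ⟪‖y‖⁻¹ • y - c, y⟫ := by
    rw [← inner_add_left, add_sub_cancel, real_inner_smul_left, real_inner_self_eq_norm_sq, sq,
      inv_mul_cancel_left₀ hp.ne']
  have h2 := (real_inner_le_norm (‖y‖⁻¹ • y - c) y).trans
    (mul_le_mul_of_nonneg_right hxc hp.le)
  have := hy c hc
  linarith

theorem HasSubgaussianMGF.mono {Ω : Type*} [MeasurableSpace Ω] {μ : Measure Ω} {X : Ω → ℝ}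
    {c c' : ℝ≥0} (h : HasSubgaussianMGF X c μ) (hc : c ≤ c') : HasSubgaussianMGF X c' μ where
  integrable_exp_mul := h.integrable_exp_mul
  mgf_le t := (h.mgf_le t).trans (Real.exp_le_exp.2 (by
    have : (c : ℝ) ≤ c' := hc
    gcongr))

section Noise

variable {n q : ℕ} {Ω : Type*} [MeasurableSpace Ω] {μ : Measure Ω}
  {E : Fin n → Fin q → Ω → ℝ} {σ : ℝ} {κ : ℝ≥0}

/-- Variance proxies of independent terms add, and the squared weights sum to `‖y‖² ‖x‖² ≤ 1`. -/
theorem ErrorCondition.hasSubgaussianMGF (h : ErrorCondition μ E σ κ)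
    {y : EuclideanSpace ℝ (Fin n)} {x : EuclideanSpace ℝ (Fin q)} (hy : ‖y‖ ≤ 1) (hx : ‖x‖ ≤ 1) :
    HasSubgaussianMGF (fun ω => ∑ ij : Fin n × Fin q, y ij.1 * x ij.2 * E ij.1 ij.2 ω)
      (κ * Real.toNNReal σ ^ 2) μ := by
  have hind : iIndepFun (fun (ij : Fin n × Fin q) ω => y ij.1 * x ij.2 * E ij.1 ij.2 ω) μ :=
    h.indep.comp (fun ij a => y ij.1 * x ij.2 * a) fun ij => measurable_const_mul _
  have hs := HasSubgaussianMGF.sum_of_iIndepFun hind (s := Finset.univ)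
    (c := fun ij => Real.toNNReal ((y ij.1 * x ij.2) ^ 2) * (κ * Real.toNNReal σ ^ 2))
    fun ij _ => by
      rw [Real.toNNReal_of_nonneg (sq_nonneg _)]
      exact (h.subgaussian ij.1 ij.2).const_mul (y ij.1 * x ij.2)
  refine HasSubgaussianMGF.mono hs ?_
  rw [← Finset.sum_mul]
  refine mul_le_of_le_one_left zero_le ?_
  rw [← NNReal.coe_le_coe, NNReal.coe_sum]
  have h1 : ∑ ij : Fin n × Fin q, (y ij.1 * x ij.2) ^ 2 = ‖y‖ ^ 2 * ‖x‖ ^ 2 := by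
    rw [EuclideanSpace.real_norm_sq_eq, EuclideanSpace.real_norm_sq_eq, Fintype.sum_prod_type,
      Finset.sum_mul_sum]
    simp only [mul_pow]
  simp only [Real.coe_toNNReal _ (sq_nonneg _)]
  refine h1.le.trans ?_
  exact mul_le_one₀ (pow_le_one₀ (norm_nonneg _) hy) (sq_nonneg _) (pow_le_one₀ (norm_nonneg _) hx)

theorem inner_toEuclideanLin (A : Matrix (Fin n) (Fin q) ℝ) (y : EuclideanSpace ℝ (Fin n))
    (x : EuclideanSpace ℝ (Fin q)) :
    ⟪y, A.toEuclideanLin x⟫ = ∑ ij : Fin n × Fin q, y ij.1 * x ij.2 * A ij.1 ij.2 := by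
  simp only [PiLp.inner_apply, Matrix.toLpLin_apply, Matrix.mulVec, dotProduct,
    Fintype.sum_prod_type]
  refine Finset.sum_congr rfl fun i _ => ?_
  simp only [RCLike.inner_apply, conj_trivial, Finset.sum_mul]
  exact Finset.sum_congr rfl fun j _ => by ring

/-- The noise level `12 √(κ + 1) σ (√n + √q)`. -/
noncomputable def noiseLevel (n q : ℕ) (σ : ℝ) (κ : ℝ≥0) : ℝ :=
  12 * √((κ : ℝ) + 1) * (σ * (√(n : ℝ) + √(q : ℝ)))

/-- A union bound over pairs of net points controls the bilinear form of the noise; each of the two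
nets costs a factor `2` in passing to the operator norm, whence `12 = 2 · 2 · 3`. -/
theorem ErrorCondition.exists_event [IsProbabilityMeasure μ] (h : ErrorCondition μ E σ κ)
    (hσ : 0 < σ) : ∃ A : Set Ω, MeasurableSet A ∧
      1 - Real.exp (-(√(n : ℝ) + √(q : ℝ)) ^ 2) ≤ μ.real A ∧
      ∀ ω ∈ A, ∀ x, ‖(Matrix.of fun i j => E i j ω).toEuclideanLin x‖ ≤
        noiseLevel n q σ κ * ‖x‖ := by
  obtain ⟨N, hNc, hN1, hN⟩ := exists_half_net (EuclideanSpace ℝ (Fin n))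
  obtain ⟨M, hMc, hM1, hM⟩ := exists_half_net (EuclideanSpace ℝ (Fin q))
  rw [finrank_euclideanSpace_fin] at hNc hMc
  set S : ℝ := √(n : ℝ) + √(q : ℝ) with hS
  -- The tail at `t` is `exp (-9 S² / 2)`, while the number of pairs is at most `5 ^ (n + q) ≤ exp
  -- (2 S²)`, which leaves more than `exp (-S²)` requires. Using `κ + 1` in place of `κ` keeps the
  -- proxy positive.
  set t : ℝ := 3 * √((κ : ℝ) + 1) * (σ * S) with ht
  have hS0 : 0 ≤ S := by positivity
  have ht0 : 0 ≤ t := by positivity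
  let B : EuclideanSpace ℝ (Fin n) × EuclideanSpace ℝ (Fin q) → Set Ω := fun yx =>
    {ω | t ≤ ∑ ij : Fin n × Fin q, yx.1 ij.1 * yx.2 ij.2 * E ij.1 ij.2 ω}
  have hBm : ∀ yx, MeasurableSet (B yx) := fun yx =>
    measurableSet_le measurable_const
      (Finset.measurable_sum _ fun ij _ => (h.measurable ij.1 ij.2).const_mul _)
  have hB : ∀ yx ∈ N ×ˢ M, μ.real (B yx) ≤ Real.exp (-(9 / 2) * S ^ 2) := fun yx hyx => by
    rw [Finset.mem_product] at hyx
    have h1 := HasSubgaussianMGF.mono (c' := (κ + 1) * Real.toNNReal σ ^ 2)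
      (h.hasSubgaussianMGF (hN1 _ hyx.1) (hM1 _ hyx.2))
      (mul_le_mul_of_nonneg_right (by simp) zero_le)
    refine (h1.measure_ge_le ht0).trans_eq ?_
    congr 1
    push_cast
    rw [Real.coe_toNNReal _ hσ.le, ht, mul_pow, mul_pow, Real.sq_sqrt (by positivity)]
    field_simp
    ring
  refine ⟨(⋃ yx ∈ N ×ˢ M, B yx)ᶜ, (Finset.measurableSet_biUnion _ fun yx _ => hBm yx).compl,
    ?_, fun ω hω x => ?_⟩
  · rw [probReal_compl_eq_one_sub (Finset.measurableSet_biUnion _ fun yx _ => hBm yx)]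
    refine sub_le_sub_left ?_ _
    calc μ.real (⋃ yx ∈ N ×ˢ M, B yx) ≤ ∑ yx ∈ N ×ˢ M, μ.real (B yx) :=
          measureReal_biUnion_finset_le _ _
      _ ≤ (N ×ˢ M).card • Real.exp (-(9 / 2) * S ^ 2) := Finset.sum_le_card_nsmul _ _ _ hB
      _ ≤ Real.exp (2 * S ^ 2) * Real.exp (-(9 / 2) * S ^ 2) := by
        rw [nsmul_eq_mul]
        refine mul_le_mul_of_nonneg_right ?_ (Real.exp_pos _).le
        have h5 : (5 : ℝ) ≤ Real.exp 2 := by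
          have h1 := Real.exp_one_gt_d9
          have h2 : Real.exp 2 = Real.exp 1 * Real.exp 1 := by
            rw [← Real.exp_add]
            norm_num
          rw [h2]
          nlinarith
        calc ((N ×ˢ M).card : ℝ) ≤ ((5 ^ n * 5 ^ q : ℕ) : ℝ) := by
              rw [Finset.card_product]
              exact_mod_cast Nat.mul_le_mul hNc hMc
          _ = 5 ^ (n + q) := by push_cast; ring
          _ ≤ Real.exp 2 ^ (n + q) := pow_le_pow_left₀ (by norm_num) h5 _
          _ = Real.exp (2 * (n + q)) := by rw [← Real.exp_nat_mul]; push_cast; ring_nf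
          _ ≤ Real.exp (2 * S ^ 2) := by
            rw [Real.exp_le_exp, hS, add_sq, Real.sq_sqrt (by positivity),
              Real.sq_sqrt (by positivity)]
            have : 0 ≤ √(n : ℝ) * √(q : ℝ) := by positivity
            linarith
      _ ≤ Real.exp (-S ^ 2) := by
        rw [← Real.exp_add, Real.exp_le_exp]
        linarith [sq_nonneg S]
  · set L := LinearMap.toContinuousLinearMap ((Matrix.of fun i j => E i j ω).toEuclideanLin)
    have hL : ‖L‖ ≤ 2 * (2 * t) := by
      refine norm_map_le_of_half_net L hM (by positivity) fun c hc => ?_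
      refine norm_le_of_half_net hN fun y hy => ?_
      by_contra! hlt
      apply hω
      refine Set.mem_iUnion₂.2 ⟨(y, c), Finset.mk_mem_product hy hc, ?_⟩
      have h1 : ⟪y, L c⟫ = _ := inner_toEuclideanLin _ y c
      rw [h1] at hlt
      exact hlt.le
    refine (L.le_of_opNorm_le hL x).trans_eq ?_
    rw [noiseLevel, ht]
    ring

end Noise

/-! ### Vector norms and correlation with normalised columns. -/

section Norms

variable {n p : ℕ}

theorem l2norm_nonneg (v : Fin p → ℝ) : 0 ≤ l2norm v := norm_nonneg _

theorem l2norm_sq (v : Fin p → ℝ) : l2norm v ^ 2 = ∑ i, v i ^ 2 := by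
  rw [l2norm, EuclideanSpace.real_norm_sq_eq]

theorem l2norm_sq_eq_dotProduct (v : Fin p → ℝ) : l2norm v ^ 2 = v ⬝ᵥ v := by
  rw [l2norm_sq]
  simp only [dotProduct, sq]

theorem l2norm_zero : l2norm (0 : Fin p → ℝ) = 0 := by
  simp [l2norm]

theorem l2norm_smul (a : ℝ) (v : Fin p → ℝ) : l2norm (a • v) = |a| * l2norm v := by
  rw [l2norm, WithLp.toLp_smul, norm_smul, Real.norm_eq_abs, l2norm]

theorem l2norm_add_le (v w : Fin p → ℝ) : l2norm (v + w) ≤ l2norm v + l2norm w := by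
  rw [l2norm, WithLp.toLp_add]
  exact norm_add_le _ _

theorem l2norm_sub_le (v w : Fin p → ℝ) : l2norm (v - w) ≤ l2norm v + l2norm w := by
  rw [l2norm, WithLp.toLp_sub]
  exact norm_sub_le _ _

theorem abs_dotProduct_le (v w : Fin p → ℝ) : |v ⬝ᵥ w| ≤ l2norm v * l2norm w := by
  have := abs_real_inner_le_norm (WithLp.toLp 2 v) (WithLp.toLp 2 w)
  rwa [EuclideanSpace.inner_toLp_toLp, star_trivial, dotProduct_comm] at this

theorem l2norm_sub_sq (v w : Fin p → ℝ) :
    l2norm (v - w) ^ 2 = l2norm v ^ 2 - 2 * (v ⬝ᵥ w) + l2norm w ^ 2 := by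
  simp only [l2norm_sq_eq_dotProduct, sub_dotProduct, dotProduct_sub, dotProduct_comm w v]
  ring

theorem l2norm_le_l1norm (v : Fin p → ℝ) : l2norm v ≤ l1norm v := by
  have h0 : 0 ≤ l1norm v := Finset.sum_nonneg fun i _ => abs_nonneg _
  refine (abs_le_of_sq_le_sq' ?_ h0).2
  rw [l2norm_sq, l1norm]
  refine le_trans (le_of_eq ?_) (Finset.sum_sq_le_sq_sum_of_nonneg fun i _ => abs_nonneg _)
  simp

theorem l1norm_smul_sign {ε : ℝ} (hε : ε = 1 ∨ ε = -1) (v : Fin p → ℝ) :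
    l1norm (ε • v) = l1norm v := by
  rcases hε with rfl | rfl <;> simp [l1norm]

theorem abs_dotProduct_mulVec_le {X : Matrix (Fin n) (Fin p) ℝ} (hX : ColumnsNormalized X)
    (w : Fin n → ℝ) (δ : Fin p → ℝ) :
    |w ⬝ᵥ (X *ᵥ δ)| ≤ √(n : ℝ) * l2norm w * l1norm δ := by
  rw [Matrix.dotProduct_mulVec, dotProduct, l1norm, Finset.mul_sum]
  refine (Finset.abs_sum_le_sum_abs _ _).trans (Finset.sum_le_sum fun j _ => ?_)
  rw [abs_mul]
  refine mul_le_mul_of_nonneg_right ?_ (abs_nonneg _)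
  have := abs_dotProduct_le w (X.col j)
  rw [hX j, mul_comm] at this
  exact this

end Norms

/-! ### Consequences of the restricted eigenvalue condition. -/

section RestrictedEigenvalues

variable {n p : ℕ}

theorem exists_isLargestOutside (s : ℕ) (δ : Fin p → ℝ) (J : Finset (Fin p)) :
    ∃ T, IsLargestOutside s δ J T := by
  induction s with
  | zero => exact ⟨∅, by simp [IsLargestOutside]⟩
  | succ s ih =>
    obtain ⟨T, hT, hc, hmax⟩ := ih
    rcases (Jᶜ \ T).eq_empty_or_nonempty with h0 | h0
    · have hTJ : T = Jᶜ := Finset.Subset.antisymm hT (Finset.sdiff_eq_empty_iff_subset.1 h0)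
      refine ⟨T, hT, ?_, hmax⟩
      rw [hTJ] at hc ⊢
      omega
    · obtain ⟨i, hi, himax⟩ := (Jᶜ \ T).exists_max_image (fun j => |δ j|) h0
      have hi' := Finset.mem_sdiff.1 hi
      refine ⟨insert i T, Finset.insert_subset hi'.1 hT, ?_, ?_⟩
      · rw [Finset.card_insert_of_notMem hi'.2]
        have : T.card < Jᶜ.card := Finset.card_lt_card
          ⟨hT, fun h => hi'.2 (h hi'.1)⟩
        omega
      · intro a ha j hj
        have hj' : j ∈ Jᶜ \ T := by
          rw [Finset.mem_sdiff] at hj ⊢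
          exact ⟨hj.1, fun h => hj.2 (Finset.mem_insert_of_mem h)⟩
        rcases Finset.mem_insert.1 ha with rfl | ha
        · exact himax j hj'
        · exact hmax a ha j hj'

variable {X : Matrix (Fin n) (Fin p) ℝ} {s : ℕ} {ρ : ℝ}

theorem RestrictedEigenvalue.mul_sum_sq_le (h : RestrictedEigenvalue X s ρ) (hn : 0 < n)
    {δ : Fin p → ℝ} {J T : Finset (Fin p)} (hJ : J.card ≤ s)
    (hcone : ∑ j ∈ Jᶜ, |δ j| ≤ 3 * ∑ j ∈ J, |δ j|) (hT : IsLargestOutside s δ J T) :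
    ρ * n * ∑ j ∈ J, δ j ^ 2 ≤ l2norm (X *ᵥ δ) ^ 2 ∧
      ρ * n * ∑ j ∈ T, δ j ^ 2 ≤ l2norm (X *ᵥ δ) ^ 2 := by
  rcases eq_or_ne δ 0 with rfl | hδ
  · simp [sq_nonneg]
  have hn' : (0 : ℝ) < n := Nat.cast_pos.2 hn
  -- Were `δ` zero on `J`, the cone condition would make it vanish everywhere. The denominator is
  -- thus positive and can be cleared.
  have hJ0 : 0 < ∑ j ∈ J, δ j ^ 2 := by
    have hnn : 0 ≤ ∑ j ∈ J, δ j ^ 2 := Finset.sum_nonneg fun j _ => sq_nonneg _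
    refine lt_of_le_of_ne hnn fun h0 => hδ ?_
    have h1 := (Finset.sum_eq_zero_iff_of_nonneg fun j _ => sq_nonneg (δ j)).1 h0.symm
    have h2 : ∑ j ∈ J, |δ j| = 0 := Finset.sum_eq_zero fun j hj => by
      rw [pow_eq_zero_iff two_ne_zero |>.1 (h1 j hj), abs_zero]
    rw [h2, mul_zero] at hcone
    have h3 := (Finset.sum_eq_zero_iff_of_nonneg fun j _ => abs_nonneg (δ j)).1
      (le_antisymm hcone (Finset.sum_nonneg fun j _ => abs_nonneg _))
    ext j
    by_cases hj : j ∈ J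
    · exact pow_eq_zero_iff two_ne_zero |>.1 (h1 j hj)
    · exact abs_eq_zero.1 (h3 j (Finset.mem_compl.2 hj))
  have h1 := h δ J T hδ hJ hcone hT
  have hmax : 0 < max (∑ j ∈ J, δ j ^ 2) (∑ j ∈ T, δ j ^ 2) := lt_max_of_lt_left hJ0
  rw [le_div_iff₀ (mul_pos hn' hmax), ← mul_assoc] at h1
  rcases le_or_gt 0 ρ with hρ | hρ
  · exact ⟨(mul_le_mul_of_nonneg_left (le_max_left _ _) (by positivity)).trans h1,
      (mul_le_mul_of_nonneg_left (le_max_right _ _) (by positivity)).trans h1⟩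
  · have h2 : ρ * n ≤ 0 := mul_nonpos_of_nonpos_of_nonneg hρ.le hn'.le
    exact ⟨(mul_nonpos_of_nonpos_of_nonneg h2 hJ0.le).trans (sq_nonneg _),
      (mul_nonpos_of_nonpos_of_nonneg h2 (Finset.sum_nonneg fun j _ => sq_nonneg _)).trans
        (sq_nonneg _)⟩

/-- The constant is `11 = 1 + 1 + 9`: the condition covers `J` and the `s` largest remaining
positions `T`. Each entry beyond them is at most the average over `T`, so their squares sum to at
most `‖δ_{Jᶜ}‖₁² / s ≤ 9 ‖δ_J‖₁² / s ≤ 9 ‖δ_J‖₂²`. -/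
theorem RestrictedEigenvalue.mul_l2norm_sq_le (h : RestrictedEigenvalue X s ρ) (hn : 0 < n)
    (hρ : 0 < ρ) (hs : 0 < s) {δ : Fin p → ℝ} {J : Finset (Fin p)} (hJ : J.card ≤ s)
    (hcone : ∑ j ∈ Jᶜ, |δ j| ≤ 3 * ∑ j ∈ J, |δ j|) :
    ρ * n * l2norm δ ^ 2 ≤ 11 * l2norm (X *ᵥ δ) ^ 2 := by
  obtain ⟨T, hT⟩ := exists_isLargestOutside s δ J
  obtain ⟨h1, h2⟩ := h.mul_sum_sq_le hn hJ hcone hT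
  obtain ⟨hTJ, hTc, hTmax⟩ := hT
  have hs' : (0 : ℝ) < s := Nat.cast_pos.2 hs
  have hrest : ∑ j ∈ Jᶜ \ T, δ j ^ 2 ≤ 9 * ∑ j ∈ J, δ j ^ 2 := by
    rcases (Jᶜ \ T).eq_empty_or_nonempty with h0 | ⟨i, hi⟩
    · rw [h0, Finset.sum_empty]
      exact mul_nonneg (by norm_num) (Finset.sum_nonneg fun j _ => sq_nonneg _)
    have hi' := Finset.mem_sdiff.1 hi
    have hTs : T.card = s := by
      have : T.card < Jᶜ.card := Finset.card_lt_card ⟨hTJ, fun h => hi'.2 (h hi'.1)⟩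
      omega
    have hle : ∀ j ∈ Jᶜ \ T, s * |δ j| ≤ ∑ a ∈ Jᶜ, |δ a| := fun j hj => by
      have h3 := Finset.card_nsmul_le_sum T (fun a => |δ a|) |δ j| fun a ha => hTmax a ha j hj
      rw [hTs, nsmul_eq_mul] at h3
      exact h3.trans (Finset.sum_le_sum_of_subset_of_nonneg hTJ fun a _ _ => abs_nonneg _)
    have hL : 0 ≤ ∑ a ∈ Jᶜ, |δ a| := Finset.sum_nonneg fun a _ => abs_nonneg _
    refine le_of_mul_le_mul_left ?_ hs'
    calc s * ∑ j ∈ Jᶜ \ T, δ j ^ 2 = ∑ j ∈ Jᶜ \ T, s * |δ j| * |δ j| := by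
          rw [Finset.mul_sum]
          exact Finset.sum_congr rfl fun j _ => by rw [mul_assoc, abs_mul_abs_self, sq]
      _ ≤ ∑ j ∈ Jᶜ \ T, (∑ a ∈ Jᶜ, |δ a|) * |δ j| := Finset.sum_le_sum fun j hj =>
          mul_le_mul_of_nonneg_right (hle j hj) (abs_nonneg _)
      _ ≤ (∑ a ∈ Jᶜ, |δ a|) * ∑ a ∈ Jᶜ, |δ a| := by
          rw [← Finset.mul_sum]
          exact mul_le_mul_of_nonneg_left (Finset.sum_le_sum_of_subset_of_nonneg
            Finset.sdiff_subset fun a _ _ => abs_nonneg _) hL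
      _ ≤ (3 * ∑ j ∈ J, |δ j|) * (3 * ∑ j ∈ J, |δ j|) :=
          mul_le_mul hcone hcone hL (hL.trans hcone)
      _ = 9 * (∑ j ∈ J, |δ j|) ^ 2 := by ring
      _ ≤ 9 * (J.card * ∑ j ∈ J, |δ j| ^ 2) :=
          mul_le_mul_of_nonneg_left sq_sum_le_card_mul_sum_sq (by norm_num)
      _ ≤ 9 * (s * ∑ j ∈ J, |δ j| ^ 2) := by
          refine mul_le_mul_of_nonneg_left (mul_le_mul_of_nonneg_right (Nat.cast_le.2 hJ)
            (Finset.sum_nonneg fun j _ => sq_nonneg _)) (by norm_num)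
      _ = s * (9 * ∑ j ∈ J, δ j ^ 2) := by
          simp only [sq_abs]
          ring
  have hsplit : l2norm δ ^ 2 =
      ∑ j ∈ J, δ j ^ 2 + (∑ j ∈ T, δ j ^ 2 + ∑ j ∈ Jᶜ \ T, δ j ^ 2) := by
    rw [l2norm_sq, ← Finset.sum_add_sum_compl J, ← Finset.sum_sdiff hTJ, add_comm (∑ j ∈ T, _)]
  have hρn : 0 ≤ ρ * n := by positivity
  have h3 := mul_le_mul_of_nonneg_left hrest hρn
  rw [hsplit, mul_add, mul_add]
  linarith

/-- The support of a vector. -/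
noncomputable def supp (u : Fin p → ℝ) : Finset (Fin p) := Finset.univ.filter fun j => u j ≠ 0

theorem eq_zero_of_notMem_supp {u : Fin p → ℝ} {j : Fin p} (hj : j ∈ (supp u)ᶜ) : u j = 0 := by
  simpa [supp] using hj

theorem RestrictedEigenvalue.mul_l2norm_sq_le_of_sparse (h : RestrictedEigenvalue X s ρ)
    (hn : 0 < n) {u : Fin p → ℝ} (hu : l0norm u ≤ s) :
    ρ * n * l2norm u ^ 2 ≤ l2norm (X *ᵥ u) ^ 2 := by
  have h0 : ∑ j ∈ (supp u)ᶜ, |u j| = 0 := Finset.sum_eq_zero fun j hj => by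
    rw [eq_zero_of_notMem_supp hj, abs_zero]
  have h0' : ∑ j ∈ (supp u)ᶜ, u j ^ 2 = 0 := Finset.sum_eq_zero fun j hj => by
    rw [eq_zero_of_notMem_supp hj, sq, zero_mul]
  obtain ⟨T, hT⟩ := exists_isLargestOutside s u (supp u)
  have h1 := (h.mul_sum_sq_le hn (δ := u) (J := supp u) hu (by
    rw [h0]
    exact mul_nonneg (by norm_num) (Finset.sum_nonneg fun j _ => abs_nonneg _)) hT).1
  rwa [l2norm_sq u, ← Finset.sum_add_sum_compl (supp u), h0', add_zero]

/-- Tested on a basis vector. This allows rates with different powers of `ρ` to be compared. -/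
theorem RestrictedEigenvalue.le_one (h : RestrictedEigenvalue X s ρ) (hX : ColumnsNormalized X)
    (hn : 0 < n) (hs : 0 < s) (j : Fin p) : ρ ≤ 1 := by
  have hn' : (0 : ℝ) < n := Nat.cast_pos.2 hn
  have hl0 : l0norm (Pi.single j (1 : ℝ) : Fin p → ℝ) ≤ 1 := by
    rw [l0norm, Finset.card_le_one]
    intro a ha b hb
    simp only [Finset.mem_filter, Finset.mem_univ, true_and, ne_eq, Pi.single_apply,
      ite_eq_right_iff, one_ne_zero, imp_false, not_not] at ha hb
    rw [ha, hb]
  have h1 := h.mul_l2norm_sq_le_of_sparse hn (hl0.trans hs)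
  have h2 : l2norm (Pi.single j (1 : ℝ) : Fin p → ℝ) ^ 2 = 1 := by
    rw [l2norm_sq_eq_dotProduct]
    simp
  rw [h2, Matrix.mulVec_single_one, hX j, Real.sq_sqrt hn'.le, mul_one] at h1
  exact (mul_le_iff_le_one_left hn').1 h1

end RestrictedEigenvalues

/-! ### The Lasso with a deterministic error. -/

section Lasso

variable {n p : ℕ} {X : Matrix (Fin n) (Fin p) ℝ} {z : Fin n → ℝ} {lam : ℝ} {v : Fin p → ℝ}

theorem IsLasso.smul_sign (h : IsLasso X z lam v) {ε : ℝ} (hε : ε = 1 ∨ ε = -1) :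
    IsLasso X (ε • z) lam (ε • v) := by
  have hε2 : ε * ε = 1 := by rcases hε with rfl | rfl <;> norm_num
  have habs : |ε| = 1 := by rcases hε with rfl | rfl <;> norm_num
  have key : ∀ w : Fin p → ℝ, l2norm (√(n : ℝ) • ε • z - X *ᵥ w) =
      l2norm (√(n : ℝ) • z - X *ᵥ (ε • w)) := fun w => by
    rw [← one_mul (l2norm (√(n : ℝ) • z - X *ᵥ (ε • w))), ← habs, ← l2norm_smul, smul_sub,
      Matrix.mulVec_smul, smul_smul ε ε, hε2, one_smul, smul_comm]
  intro w
  have := h (ε • w)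
  rwa [key, key, l1norm_smul_sign hε, smul_smul, hε2, one_smul, ← l1norm_smul_sign hε w]

/-- The objective equals `1` at the zero vector. This bounds the estimate when the penalty is large.
-/
theorem IsLasso.mul_l1norm_le (h : IsLasso X z lam v) (hn : 0 < n) (hz : l2norm z = 1) :
    lam * l1norm v ≤ 1 := by
  have hn' : (0 : ℝ) < n := Nat.cast_pos.2 hn
  have h1 := h 0
  rw [Matrix.mulVec_zero, sub_zero, l2norm_smul, hz, mul_one, sq_abs, Real.sq_sqrt hn'.le,
    inv_mul_cancel₀ hn'.ne'] at h1
  have h2 : l1norm (0 : Fin p → ℝ) = 0 := by simp [l1norm]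
  rw [h2] at h1
  have : 0 ≤ (n : ℝ)⁻¹ * l2norm (√(n : ℝ) • z - X *ᵥ v) ^ 2 := by positivity
  linarith

theorem IsLasso.l2norm_mulVec_le (h : IsLasso X z lam v) (hn : 0 < n) (hz : l2norm z = 1)
    (hlam : 0 ≤ lam) : l2norm (X *ᵥ v) ≤ 2 * √(n : ℝ) := by
  have hn' : (0 : ℝ) < n := Nat.cast_pos.2 hn
  have h1 := h 0
  rw [Matrix.mulVec_zero, sub_zero, l2norm_smul, hz, mul_one, sq_abs, Real.sq_sqrt hn'.le,
    inv_mul_cancel₀ hn'.ne'] at h1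
  have h2 : l1norm (0 : Fin p → ℝ) = 0 := by simp [l1norm]
  have h3 : 0 ≤ lam * l1norm v := mul_nonneg hlam (Finset.sum_nonneg fun j _ => abs_nonneg _)
  have h4 : (n : ℝ)⁻¹ * l2norm (√(n : ℝ) • z - X *ᵥ v) ^ 2 ≤ 1 := by
    rw [h2] at h1
    linarith
  rw [inv_mul_le_iff₀ hn', mul_one] at h4
  have h5 : l2norm (√(n : ℝ) • z - X *ᵥ v) ≤ √(n : ℝ) := Real.le_sqrt_of_sq_le h4
  have h6 := l2norm_sub_le (√(n : ℝ) • z) (√(n : ℝ) • z - X *ᵥ v)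
  rw [sub_sub_cancel, l2norm_smul, hz, mul_one, abs_of_nonneg (Real.sqrt_nonneg _)] at h6
  linarith

/-- Comparing the objective at `v` and at `u` leaves a cross term of at most `2 ‖w‖₂ ‖δ‖₁ ≤ (lam /
2) ‖δ‖₁`, where `w` is the error. Off the support of `u` the penalty outweighs it; as the left side
is non-negative, `δ` lies in the cone. -/
theorem IsLasso.basic_inequality (h : IsLasso X z lam v) (hX : ColumnsNormalized X) (hn : 0 < n)
    {u : Fin p → ℝ} (hlam : 4 * l2norm (z - (√(n : ℝ))⁻¹ • (X *ᵥ u)) ≤ lam) :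
    (n : ℝ)⁻¹ * l2norm (X *ᵥ (v - u)) ^ 2 ≤
      lam / 2 * (3 * ∑ j ∈ supp u, |(v - u) j| - ∑ j ∈ (supp u)ᶜ, |(v - u) j|) := by
  have hn' : (0 : ℝ) < n := Nat.cast_pos.2 hn
  have hsn : 0 < √(n : ℝ) := Real.sqrt_pos.2 hn'
  set w := z - (√(n : ℝ))⁻¹ • (X *ᵥ u) with hw
  set δ := v - u with hδ
  have hlam0 : 0 ≤ lam := (mul_nonneg (by norm_num) (l2norm_nonneg _)).trans hlam
  have hu : √(n : ℝ) • z - X *ᵥ u = √(n : ℝ) • w := by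
    rw [hw, smul_sub, smul_smul, mul_inv_cancel₀ hsn.ne', one_smul]
  have hv : √(n : ℝ) • z - X *ᵥ v = √(n : ℝ) • w - X *ᵥ δ := by
    rw [← hu, hδ, Matrix.mulVec_sub]
    abel
  have h1 := h u
  rw [hu, hv, l2norm_sub_sq, smul_dotProduct, smul_eq_mul] at h1
  have h2 := le_of_abs_le (abs_dotProduct_mulVec_le hX w δ)
  have hl1 : l1norm δ = ∑ j ∈ supp u, |δ j| + ∑ j ∈ (supp u)ᶜ, |δ j| :=
    (Finset.sum_add_sum_compl _ _).symm
  have hl1v : l1norm u - l1norm v ≤ ∑ j ∈ supp u, |δ j| - ∑ j ∈ (supp u)ᶜ, |δ j| := by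
    rw [l1norm, l1norm, ← Finset.sum_add_sum_compl (supp u), ← Finset.sum_add_sum_compl (supp u)
      fun j => |v j|]
    have a1 : ∑ j ∈ (supp u)ᶜ, |u j| = 0 := Finset.sum_eq_zero fun j hj => by
      rw [eq_zero_of_notMem_supp hj, abs_zero]
    have a2 : ∑ j ∈ (supp u)ᶜ, |v j| = ∑ j ∈ (supp u)ᶜ, |δ j| :=
      Finset.sum_congr rfl fun j hj => by
        rw [hδ, Pi.sub_apply, eq_zero_of_notMem_supp hj, sub_zero]
    have a3 : ∑ j ∈ supp u, |u j| ≤ ∑ j ∈ supp u, |v j| + ∑ j ∈ supp u, |δ j| := by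
      rw [← Finset.sum_add_distrib]
      refine Finset.sum_le_sum fun j _ => ?_
      rw [hδ, Pi.sub_apply, abs_sub_comm (v j)]
      linarith [abs_sub_abs_le_abs_sub (u j) (v j)]
    linarith
  have h3 : (n : ℝ)⁻¹ * (2 * (√(n : ℝ) * (w ⬝ᵥ X *ᵥ δ))) ≤ lam / 2 * l1norm δ := by
    rw [inv_mul_le_iff₀ hn']
    have hl10 : 0 ≤ l1norm δ := Finset.sum_nonneg fun j _ => abs_nonneg _
    calc 2 * (√(n : ℝ) * (w ⬝ᵥ X *ᵥ δ))
        ≤ 2 * (√(n : ℝ) * (√(n : ℝ) * l2norm w * l1norm δ)) := by gcongr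
      _ = √(n : ℝ) ^ 2 * (2 * l2norm w * l1norm δ) := by ring
      _ = n * (2 * l2norm w * l1norm δ) := by rw [Real.sq_sqrt hn'.le]
      _ ≤ n * (lam / 2 * l1norm δ) := by
        gcongr
        linarith
  have h4 := mul_le_mul_of_nonneg_left hl1v hlam0
  rw [hl1] at h3
  linarith

variable {s : ℕ} {ρ : ℝ}

/-- Prediction and estimation error bounds for the Lasso. -/
theorem IsLasso.error_bounds (h : IsLasso X z lam v) (hX : ColumnsNormalized X) (hn : 0 < n)
    (hRE : RestrictedEigenvalue X s ρ) (hρ : 0 < ρ) (hs : 0 < s) {u : Fin p → ℝ}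
    (hu : l0norm u ≤ s) (hlam0 : 0 < lam)
    (hlam : 4 * l2norm (z - (√(n : ℝ))⁻¹ • (X *ᵥ u)) ≤ lam) :
    l2norm (X *ᵥ (v - u)) / √(n : ℝ) ≤ 3 / 2 * lam * √(l0norm u : ℝ) / √ρ ∧
      l2norm (v - u) ≤ 6 * lam * √(l0norm u : ℝ) / ρ := by
  have hn' : (0 : ℝ) < n := Nat.cast_pos.2 hn
  have hb := h.basic_inequality hX hn hlam
  set δ := v - u
  set L := ∑ j ∈ supp u, |δ j|
  have hLc : 0 ≤ ∑ j ∈ (supp u)ᶜ, |δ j| := Finset.sum_nonneg fun j _ => abs_nonneg _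
  have hL0 : 0 ≤ L := Finset.sum_nonneg fun j _ => abs_nonneg _
  have hcone : ∑ j ∈ (supp u)ᶜ, |δ j| ≤ 3 * L := by
    have h0 : 0 ≤ (n : ℝ)⁻¹ * l2norm (X *ᵥ δ) ^ 2 := by positivity
    have := nonneg_of_mul_nonneg_right (h0.trans hb) (by positivity)
    linarith
  have hb2 : (n : ℝ)⁻¹ * l2norm (X *ᵥ δ) ^ 2 ≤ 3 / 2 * lam * L := by
    nlinarith
  obtain ⟨T, hT⟩ := exists_isLargestOutside s δ (supp u)
  have hJ := (hRE.mul_sum_sq_le (J := supp u) hn hu hcone hT).1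
  have hδ := hRE.mul_l2norm_sq_le hn hρ hs hu hcone
  set P := l2norm (X *ᵥ δ) / √(n : ℝ) with hP
  have hP0 : 0 ≤ P := div_nonneg (l2norm_nonneg _) (Real.sqrt_nonneg _)
  have hPsq : l2norm (X *ᵥ δ) ^ 2 = n * P ^ 2 := by
    rw [hP, div_pow, Real.sq_sqrt hn'.le]
    field_simp
  rw [hPsq] at hb2 hJ hδ
  rw [inv_mul_cancel_left₀ hn'.ne'] at hb2
  have hJ2 : ρ * ∑ j ∈ supp u, δ j ^ 2 ≤ P ^ 2 := by
    refine le_of_mul_le_mul_left ?_ hn'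
    linarith
  have hδ2 : ρ * l2norm δ ^ 2 ≤ 11 * P ^ 2 := by
    refine le_of_mul_le_mul_left ?_ hn'
    linarith
  have hsρ : 0 < √ρ := Real.sqrt_pos.2 hρ
  -- Cauchy–Schwarz on the support of `u` brings in its own sparsity rather than the level `s`.
  have hLP : √ρ * L ≤ √(l0norm u : ℝ) * P := by
    refine (abs_le_of_sq_le_sq' ?_ (by positivity)).2
    rw [mul_pow, mul_pow, Real.sq_sqrt hρ.le, Real.sq_sqrt (Nat.cast_nonneg _)]
    have h1 : L ^ 2 ≤ l0norm u * ∑ j ∈ supp u, |δ j| ^ 2 := sq_sum_le_card_mul_sum_sq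
    simp only [sq_abs] at h1
    calc ρ * L ^ 2 ≤ ρ * (l0norm u * ∑ j ∈ supp u, δ j ^ 2) := by gcongr
      _ = l0norm u * (ρ * ∑ j ∈ supp u, δ j ^ 2) := by ring
      _ ≤ l0norm u * P ^ 2 := by gcongr
  have hPle : P ≤ 3 / 2 * lam * √(l0norm u : ℝ) / √ρ := by
    rw [le_div_iff₀ hsρ]
    rcases hP0.eq_or_lt with h0 | h0
    · rw [← h0, zero_mul]
      positivity
    refine le_of_mul_le_mul_left ?_ h0
    calc P * (P * √ρ) = √ρ * P ^ 2 := by ring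
      _ ≤ √ρ * (3 / 2 * lam * L) := by gcongr
      _ = 3 / 2 * lam * (√ρ * L) := by ring
      _ ≤ 3 / 2 * lam * (√(l0norm u : ℝ) * P) := by gcongr
      _ = P * (3 / 2 * lam * √(l0norm u : ℝ)) := by ring
  refine ⟨hPle, ?_⟩
  -- The constant `11` is rounded up to `4 ^ 2`.
  have h4 : √ρ * l2norm δ ≤ 4 * P := by
    refine (abs_le_of_sq_le_sq' ?_ (by positivity)).2
    rw [mul_pow, Real.sq_sqrt hρ.le]
    linarith [sq_nonneg P]
  rw [le_div_iff₀ hρ]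
  rw [le_div_iff₀ hsρ] at hPle
  calc l2norm δ * ρ = √ρ * (√ρ * l2norm δ) := by
        rw [← mul_assoc, Real.mul_self_sqrt hρ.le, mul_comm]
    _ ≤ √ρ * (4 * P) := by gcongr
    _ = 4 * (P * √ρ) := by ring
    _ ≤ 4 * (3 / 2 * lam * √(l0norm u : ℝ)) := by gcongr
    _ = 6 * lam * √(l0norm u : ℝ) := by ring

end Lasso

/-! ### Matrices as linear maps, and the first step as a truncated SVD. -/

section Bridge

variable {n q r : ℕ}

/-- The columns of a matrix as vectors of Euclidean space. -/
noncomputable def colVec (Z : Matrix (Fin n) (Fin r) ℝ) (k : Fin r) : EuclideanSpace ℝ (Fin n) :=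
  WithLp.toLp 2 (Z.col k)

/-- The entries of a matrix as a vector of Euclidean space. -/
noncomputable def entries (A : Matrix (Fin n) (Fin q) ℝ) : EuclideanSpace ℝ (Fin n × Fin q) :=
  WithLp.toLp 2 fun ij => A ij.1 ij.2

theorem inner_colVec (Z : Matrix (Fin n) (Fin r) ℝ) (x : EuclideanSpace ℝ (Fin n)) (k : Fin r) :
    ⟪colVec Z k, x⟫ = (Zᵀ *ᵥ x.ofLp) k := by
  simp only [colVec, PiLp.inner_apply, Matrix.mulVec, dotProduct, Matrix.transpose_apply,
    Matrix.col_apply, RCLike.inner_apply, conj_trivial, mul_comm]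

theorem orthonormal_colVec_iff (Z : Matrix (Fin n) (Fin r) ℝ) :
    Orthonormal ℝ (colVec Z) ↔ Zᵀ * Z = 1 := by
  rw [orthonormal_iff_ite, ← Matrix.ext_iff]
  refine forall₂_congr fun i j => ?_
  rw [inner_colVec, Matrix.one_apply]
  rfl

theorem frobNorm_eq_norm_entries (A : Matrix (Fin n) (Fin q) ℝ) : frobNorm A = ‖entries A‖ := by
  rw [frobNorm, Matrix.frobenius_norm_def, EuclideanSpace.norm_eq, Real.sqrt_eq_rpow,
    Fintype.sum_prod_type]
  simp [entries]

theorem frobNorm_sq (A : Matrix (Fin n) (Fin q) ℝ) :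
    frobNorm A ^ 2 = ∑ i, ∑ j, A i j ^ 2 := by
  rw [frobNorm_eq_norm_entries, EuclideanSpace.real_norm_sq_eq, Fintype.sum_prod_type]
  rfl

theorem frobNorm_add_le (A B : Matrix (Fin n) (Fin q) ℝ) :
    frobNorm (A + B) ≤ frobNorm A + frobNorm B := by
  simp only [frobNorm_eq_norm_entries]
  exact norm_add_le (entries A) (entries B)

theorem frobNorm_vecMulVec (x : Fin n → ℝ) (y : Fin q → ℝ) :
    frobNorm (Matrix.vecMulVec x y) = l2norm x * l2norm y := by
  have h0 : 0 ≤ frobNorm (Matrix.vecMulVec x y) := by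
    rw [frobNorm_eq_norm_entries]
    exact norm_nonneg _
  refine (sq_eq_sq₀ h0 (mul_nonneg (l2norm_nonneg x) (l2norm_nonneg y))).1 ?_
  rw [frobNorm_sq, mul_pow, l2norm_sq, l2norm_sq, Finset.sum_mul_sum]
  simp only [Matrix.vecMulVec_apply, mul_pow]

theorem inner_entries_vecMulVec (A : Matrix (Fin n) (Fin q) ℝ) (y : EuclideanSpace ℝ (Fin n))
    (x : EuclideanSpace ℝ (Fin q)) :
    ⟪entries (Matrix.vecMulVec y.ofLp x.ofLp), entries A⟫ = ⟪y, A.toEuclideanLin x⟫ := by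
  rw [inner_toEuclideanLin]
  simp only [entries, PiLp.inner_apply, RCLike.inner_apply, conj_trivial, Matrix.vecMulVec_apply]
  exact Finset.sum_congr rfl fun _ _ => mul_comm _ _

theorem inner_entries_vecMulVec_vecMulVec (y y' : EuclideanSpace ℝ (Fin n))
    (x x' : EuclideanSpace ℝ (Fin q)) :
    ⟪entries (Matrix.vecMulVec y.ofLp x.ofLp), entries (Matrix.vecMulVec y'.ofLp x'.ofLp)⟫ =
      ⟪y, y'⟫ * ⟪x, x'⟫ := by
  simp only [entries, PiLp.inner_apply, RCLike.inner_apply, conj_trivial, Matrix.vecMulVec_apply,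
    Fintype.sum_prod_type, Finset.sum_mul_sum]
  exact Finset.sum_congr rfl fun _ _ => Finset.sum_congr rfl fun _ _ => by ring

/-- The matrices `z_k v_kᵀ` are orthonormal for the Frobenius inner product, so the square expands
with no mixed terms. -/
theorem frobNorm_sub_sq (Y : Matrix (Fin n) (Fin q) ℝ) {Z : Matrix (Fin n) (Fin r) ℝ}
    {V : Matrix (Fin q) (Fin r) ℝ} (hZ : Zᵀ * Z = 1) (hV : Vᵀ * V = 1) (d : Fin r → ℝ) :
    frobNorm (Y - Z * Matrix.diagonal d * Vᵀ) ^ 2 = frobNorm Y ^ 2 -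
      2 * ∑ k, d k * ⟪colVec Z k, Y.toEuclideanLin (colVec V k)⟫ + ∑ k, d k ^ 2 := by
  rw [← orthonormal_colVec_iff] at hZ hV
  let t : Fin r → EuclideanSpace ℝ (Fin n × Fin q) := fun k =>
    entries (Matrix.vecMulVec (colVec Z k).ofLp (colVec V k).ofLp)
  have ht : Orthonormal ℝ t := by
    rw [orthonormal_iff_ite]
    intro i j
    rw [inner_entries_vecMulVec_vecMulVec, orthonormal_iff_ite.1 hZ, orthonormal_iff_ite.1 hV]
    split_ifs <;> simp
  have hsum : entries (Y - Z * Matrix.diagonal d * Vᵀ) = entries Y - ∑ k, d k • t k := by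
    ext ⟨i, j⟩
    simp only [entries, t, colVec, Matrix.sub_apply, PiLp.sub_apply, WithLp.ofLp_sum,
      Finset.sum_apply, PiLp.smul_apply, smul_eq_mul, Matrix.vecMulVec_apply, Matrix.col_apply,
      Matrix.mul_apply, Matrix.transpose_apply]
    congr 1
    refine Finset.sum_congr rfl fun k _ => ?_
    rw [← Matrix.mul_apply, Matrix.mul_diagonal]
    ring
  have h1 := norm_sq_eq_sum_add ht d 0 (by simp)
  rw [add_zero, norm_zero, sq (0 : ℝ), zero_mul, add_zero] at h1
  rw [frobNorm_eq_norm_entries, frobNorm_eq_norm_entries, hsum, norm_sub_sq_real, h1, inner_sum]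
  congr 3
  refine Finset.sum_congr rfl fun k _ => ?_
  rw [inner_smul_right, real_inner_comm, inner_entries_vecMulVec]

/-- For fixed orthonormal families the best weights are the products `⟪z_k, Y v_k⟫`; competitors may
use them because `d'` need not be ordered or non-negative. Taking the minimizer's own families as
competitor forces `d` to equal these products, and what remains is maximality of the sum of their
squares. -/
theorem IsFirstStep.isTruncatedSVD {Y : Matrix (Fin n) (Fin q) ℝ} {Z : Matrix (Fin n) (Fin r) ℝ}
    {d : Fin r → ℝ} {V : Matrix (Fin q) (Fin r) ℝ} (h : IsFirstStep Y Z d V) (hn : 0 < n)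
    (hq : 0 < q) : IsTruncatedSVD Y.toEuclideanLin (colVec Z) (colVec V) d := by
  have hnq : (0 : ℝ) < ((n : ℝ) * q)⁻¹ := by positivity
  have hmin : ∀ (Z' : Matrix (Fin n) (Fin r) ℝ) (V' : Matrix (Fin q) (Fin r) ℝ),
      Z'ᵀ * Z' = 1 → V'ᵀ * V' = 1 →
      ∑ k, d k ^ 2 - 2 * ∑ k, d k * ⟪colVec Z k, Y.toEuclideanLin (colVec V k)⟫ ≤
        - ∑ k, ⟪colVec Z' k, Y.toEuclideanLin (colVec V' k)⟫ ^ 2 := fun Z' V' hZ' hV' => by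
    have h1 := le_of_mul_le_mul_left (h.minimal Z'
      (fun k => ⟪colVec Z' k, Y.toEuclideanLin (colVec V' k)⟫) V' hZ' hV') hnq
    rw [frobNorm_sub_sq Y h.left_orthonormal h.right_orthonormal, frobNorm_sub_sq Y hZ' hV'] at h1
    simp only [← sq] at h1
    linarith
  have hd : ∀ k, ⟪colVec Z k, Y.toEuclideanLin (colVec V k)⟫ = d k := fun k => by
    have h1 := hmin Z V h.left_orthonormal h.right_orthonormal
    have h2 : ∑ k, (⟪colVec Z k, Y.toEuclideanLin (colVec V k)⟫ - d k) ^ 2 ≤ 0 := by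
      have : ∑ k, (⟪colVec Z k, Y.toEuclideanLin (colVec V k)⟫ - d k) ^ 2 =
          ∑ k, ⟪colVec Z k, Y.toEuclideanLin (colVec V k)⟫ ^ 2 -
            2 * ∑ k, d k * ⟪colVec Z k, Y.toEuclideanLin (colVec V k)⟫ + ∑ k, d k ^ 2 := by
        rw [Finset.mul_sum, ← Finset.sum_sub_distrib, ← Finset.sum_add_distrib]
        exact Finset.sum_congr rfl fun k _ => by ring
      linarith
    have h3 := (Finset.sum_eq_zero_iff_of_nonneg fun j _ => sq_nonneg
      (⟪colVec Z j, Y.toEuclideanLin (colVec V j)⟫ - d j)).1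
      (le_antisymm h2 (Finset.sum_nonneg fun j _ => sq_nonneg _)) k (Finset.mem_univ k)
    exact sub_eq_zero.1 (pow_eq_zero_iff two_ne_zero |>.1 h3)
  refine isTruncatedSVD_of_maximal (fun z' v' hz' hv' => ?_)
    ((orthonormal_colVec_iff Z).2 h.left_orthonormal)
    ((orthonormal_colVec_iff V).2 h.right_orthonormal) hd h.nonneg h.antitone
  have h1 := hmin (Matrix.of fun i k => z' k i) (Matrix.of fun i k => v' k i)
    ((orthonormal_colVec_iff _).1 hz') ((orthonormal_colVec_iff _).1 hv')
  change _ ≤ - ∑ k, ⟪z' k, Y.toEuclideanLin (v' k)⟫ ^ 2 at h1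
  simp only [hd, ← sq] at h1 ⊢
  linarith

theorem mul_diagonal_mul_transpose_map {W : Matrix (Fin n) (Fin r) ℝ}
    {V : Matrix (Fin q) (Fin r) ℝ} (hV : Vᵀ * V = 1) (m : Fin r → ℝ) (k : Fin r) :
    (W * Matrix.diagonal m * Vᵀ).toEuclideanLin (colVec V k) = m k • colVec W k := by
  have h1 : (W * Matrix.diagonal m * Vᵀ) *ᵥ V.col k = m k • W.col k := by
    have h2 : (W * Matrix.diagonal m * Vᵀ) *ᵥ V.col k =
        (W * Matrix.diagonal m * Vᵀ * V).col k := rfl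
    rw [h2, Matrix.mul_assoc _ Vᵀ, hV, Matrix.mul_one]
    ext i
    simp [Matrix.mul_diagonal, mul_comm]
  rw [colVec, Matrix.toLpLin_apply, h1]
  rfl

theorem mul_diagonal_mul_transpose_map_eq_zero (W : Matrix (Fin n) (Fin r) ℝ)
    {V : Matrix (Fin q) (Fin r) ℝ} (m : Fin r → ℝ) {x : EuclideanSpace ℝ (Fin q)}
    (hx : ∀ k, ⟪colVec V k, x⟫ = 0) : (W * Matrix.diagonal m * Vᵀ).toEuclideanLin x = 0 := by
  have h1 : Vᵀ *ᵥ x.ofLp = 0 := by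
    ext k
    rw [← inner_colVec, hx, Pi.zero_apply]
  rw [Matrix.toLpLin_apply, ← Matrix.mulVec_mulVec, h1, Matrix.mulVec_zero]
  rfl

theorem adjoint_mul_diagonal_mul_transpose (W : Matrix (Fin n) (Fin r) ℝ)
    (V : Matrix (Fin q) (Fin r) ℝ) (m : Fin r → ℝ) :
    (W * Matrix.diagonal m * Vᵀ).toEuclideanLin.adjoint =
      (V * Matrix.diagonal m * Wᵀ).toEuclideanLin := by
  rw [← Matrix.toEuclideanLin_conjTranspose_eq_adjoint, Matrix.conjTranspose_eq_transpose_of_trivial,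
    Matrix.transpose_mul, Matrix.transpose_mul, Matrix.transpose_transpose,
    Matrix.diagonal_transpose, Matrix.mul_assoc]

theorem isTruncatedSVD_mul_diagonal_mul_transpose {W : Matrix (Fin n) (Fin r) ℝ}
    {V : Matrix (Fin q) (Fin r) ℝ} (hW : Wᵀ * W = 1) (hV : Vᵀ * V = 1) {m : Fin r → ℝ}
    (hm : ∀ k, 0 ≤ m k) (hma : Antitone m) :
    IsTruncatedSVD (W * Matrix.diagonal m * Vᵀ).toEuclideanLin (colVec W) (colVec V) m where
  left := (orthonormal_colVec_iff W).2 hW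
  right := (orthonormal_colVec_iff V).2 hV
  nonneg := hm
  antitone := hma
  map := mul_diagonal_mul_transpose_map hV m
  map_adjoint k := by
    rw [adjoint_mul_diagonal_mul_transpose, mul_diagonal_mul_transpose_map hW]
  rest x hx k := by
    rw [mul_diagonal_mul_transpose_map_eq_zero W m hx, norm_zero]
    exact mul_nonneg (hm k) (norm_nonneg _)

end Bridge

theorem norm_adjoint_le {F G : Type*} [NormedAddCommGroup F] [InnerProductSpace ℝ F]
    [FiniteDimensional ℝ F] [NormedAddCommGroup G] [InnerProductSpace ℝ G] [FiniteDimensional ℝ G]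
    {T : G →ₗ[ℝ] F} {η : ℝ} (hη : 0 ≤ η) (h : ∀ x, ‖T x‖ ≤ η * ‖x‖) (y : F) :
    ‖T.adjoint y‖ ≤ η * ‖y‖ := by
  rcases (norm_nonneg (T.adjoint y)).eq_or_lt with h0 | h0
  · rw [← h0]
    positivity
  refine le_of_mul_le_mul_left ?_ h0
  calc ‖T.adjoint y‖ * ‖T.adjoint y‖ = ⟪y, T (T.adjoint y)⟫ := by
        rw [← LinearMap.adjoint_inner_left, real_inner_self_eq_norm_mul_norm]
    _ ≤ ‖y‖ * (η * ‖T.adjoint y‖) :=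
        (real_inner_le_norm _ _).trans (mul_le_mul_of_nonneg_left (h _) (norm_nonneg _))
    _ = ‖T.adjoint y‖ * (η * ‖y‖) := by ring

/-! ### Separation of the true singular values. -/

section SingularValues

variable {r q : ℕ} {d : Fin r → ℝ} {γ b : ℝ}

theorem nextValue_nonneg (hd : ∀ k, 0 < d k) (k : Fin r) : 0 ≤ nextValue d k := by
  unfold nextValue
  split_ifs
  · exact (hd _).le
  · exact le_rfl

theorem le_nextValue (hd : Antitone d) {j k : Fin r} (hjk : j < k) : d k ≤ nextValue d j := by
  have h : (j : ℕ) + 1 < r := lt_of_le_of_lt hjk k.isLt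
  rw [nextValue, dif_pos h]
  exact hd hjk

theorem SingularValueCondition.le_sub (h : SingularValueCondition q d γ b) (hq : 0 < q)
    (k : Fin r) : γ * √(q : ℝ) ≤ d k - nextValue d k := by
  have := h.gap k
  rwa [le_div_iff₀ (Real.sqrt_pos.2 (Nat.cast_pos.2 hq))] at this

theorem SingularValueCondition.le_abs_sub (h : SingularValueCondition q d γ b) (hq : 0 < q)
    (hd : Antitone d) {j k : Fin r} (hjk : j ≠ k) : γ * √(q : ℝ) ≤ |d j - d k| := by
  rcases lt_or_gt_of_ne hjk with hlt | hlt
  · exact (h.le_sub hq j).trans ((sub_le_sub_left (le_nextValue hd hlt) _).trans (le_abs_self _))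
  · rw [abs_sub_comm]
    exact (h.le_sub hq k).trans ((sub_le_sub_left (le_nextValue hd hlt) _).trans (le_abs_self _))

theorem SingularValueCondition.le_self (h : SingularValueCondition q d γ b) (hq : 0 < q)
    (hd : ∀ k, 0 < d k) (k : Fin r) : γ * √(q : ℝ) ≤ d k := by
  linarith [h.le_sub hq k, nextValue_nonneg hd k]

end SingularValues

/-! ### Rank-one layers. -/

section Layers

variable {n p q : ℕ}

theorem mul_layer (X : Matrix (Fin n) (Fin p) ℝ) (d : ℝ) (u : Fin p → ℝ) (v : Fin q → ℝ) :
    X * layer d u v = layer d (X *ᵥ u) v := by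
  rw [layer, layer, Matrix.mul_smul, Matrix.mul_vecMulVec]

/-- One factor is changed at a time. The sign is inserted through `u' v'ᵀ = (ε u') (ε v')ᵀ`. -/
theorem frobNorm_layer_sub_le {ε d d' : ℝ} (hε : ε = 1 ∨ ε = -1) (hd : 0 ≤ d) (u u' : Fin p → ℝ)
    {v v' : Fin q → ℝ} (hv' : l2norm v' = 1) :
    frobNorm (layer d' u' v' - layer d u v) ≤ |d' - d| * l2norm u' + d * l2norm (ε • u' - u) +
      d * l2norm u * l2norm (ε • v' - v) := by
  have hεv : l2norm (ε • v') = 1 := by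
    rw [l2norm_smul, hv']
    rcases hε with rfl | rfl <;> norm_num
  have h1 : layer d' u' v' - layer d u v = Matrix.vecMulVec ((d' - d) • u') v' +
      Matrix.vecMulVec (d • (ε • u' - u)) (ε • v') + Matrix.vecMulVec (d • u) (ε • v' - v) := by
    ext i j
    simp only [layer, Matrix.sub_apply, Matrix.add_apply, Matrix.smul_apply,
      Matrix.vecMulVec_apply, Pi.smul_apply, Pi.sub_apply, smul_eq_mul]
    rcases hε with rfl | rfl <;> ring
  rw [h1]
  refine (frobNorm_add_le _ _).trans (add_le_add ((frobNorm_add_le _ _).trans ?_) ?_)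
  · rw [frobNorm_vecMulVec, frobNorm_vecMulVec, l2norm_smul, l2norm_smul, hv', hεv,
      abs_of_nonneg hd, mul_one, mul_one]
  · rw [frobNorm_vecMulVec, l2norm_smul, abs_of_nonneg hd]

end Layers

/-! ### Deterministic error bounds for the estimators. -/

section Model

variable {n p q r rstar : ℕ} {X : Matrix (Fin n) (Fin p) ℝ} {C : Matrix (Fin p) (Fin q) ℝ}
  {U : Matrix (Fin p) (Fin rstar) ℝ} {d : Fin rstar → ℝ} {V : Matrix (Fin q) (Fin rstar) ℝ}

theorem noiseLevel_eq (hn : 0 < n) (hq : 0 < q) (σ : ℝ) (κ : ℝ≥0) :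
    noiseLevel n q σ κ = 12 * √((κ : ℝ) + 1) * rate n q σ * (√(n : ℝ) * √(q : ℝ)) := by
  have h1 : 0 < √(n : ℝ) := Real.sqrt_pos.2 (Nat.cast_pos.2 hn)
  have h2 : 0 < √(q : ℝ) := Real.sqrt_pos.2 (Nat.cast_pos.2 hq)
  rw [noiseLevel, rate]
  field_simp
  ring

theorem rate_pos (hn : 0 < n) {σ : ℝ} (hσ : 0 < σ) : 0 < rate n q σ := by
  have h1 : 0 < √(n : ℝ) := Real.sqrt_pos.2 (Nat.cast_pos.2 hn)
  have : 0 ≤ √(q : ℝ) := Real.sqrt_nonneg _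
  rw [rate]
  positivity

theorem l2norm_col_eq_one {Z : Matrix (Fin n) (Fin r) ℝ} (hZ : Zᵀ * Z = 1) (k : Fin r) :
    l2norm (Z.col k) = 1 :=
  ((orthonormal_colVec_iff Z).2 hZ).1 k

theorem col_smul_mul (U : Matrix (Fin p) (Fin rstar) ℝ) (a : ℝ)
    (k : Fin rstar) : (a • (X * U)).col k = a • (X *ᵥ U.col k) := rfl

theorem IsLatentFactorDecomposition.pos_left (h : IsLatentFactorDecomposition X C U d V)
    (k : Fin rstar) : 0 < n := by
  rcases Nat.eq_zero_or_pos n with rfl | hn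
  · have := congrFun (congrFun h.left_orthonormal k) k
    simp [Matrix.mul_apply] at this
  · exact hn

theorem IsLatentFactorDecomposition.pos_right (h : IsLatentFactorDecomposition X C U d V)
    (k : Fin rstar) : 0 < q := by
  rcases Nat.eq_zero_or_pos q with rfl | hq
  · have := congrFun (congrFun h.right_orthonormal k) k
    simp [Matrix.mul_apply] at this
  · exact hq

theorem IsLatentFactorDecomposition.mul_eq (h : IsLatentFactorDecomposition X C U d V)
    (hn : 0 < n) : X * C = ((√(n : ℝ))⁻¹ • (X * U)) *
      Matrix.diagonal (fun k => √(n : ℝ) * d k) * Vᵀ := by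
  have hsn : 0 < √(n : ℝ) := Real.sqrt_pos.2 (Nat.cast_pos.2 hn)
  have h1 : Matrix.diagonal (fun k => √(n : ℝ) * d k) = √(n : ℝ) • Matrix.diagonal d := by
    rw [← Matrix.diagonal_smul]
    rfl
  rw [h1, h.eq_mul, Matrix.smul_mul, Matrix.mul_smul, smul_smul, inv_mul_cancel₀ hsn.ne', one_smul,
    Matrix.mul_assoc, Matrix.mul_assoc, Matrix.mul_assoc]

theorem IsLatentFactorDecomposition.l2norm_mulVec (h : IsLatentFactorDecomposition X C U d V)
    (k : Fin rstar) : l2norm (X *ᵥ U.col k) = √(n : ℝ) := by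
  have hsn : 0 < √(n : ℝ) := Real.sqrt_pos.2 (Nat.cast_pos.2 (h.pos_left k))
  have h1 := l2norm_col_eq_one h.left_orthonormal k
  rw [col_smul_mul, l2norm_smul, abs_of_pos (inv_pos.2 hsn),
    inv_mul_eq_one₀ hsn.ne'] at h1
  exact h1.symm

theorem IsLatentFactorDecomposition.l0norm_pos (h : IsLatentFactorDecomposition X C U d V)
    (k : Fin rstar) : 0 < l0norm (U.col k) := by
  rw [l0norm, Finset.card_pos, Finset.filter_nonempty_iff]
  by_contra! hno
  have h0 : U.col k = 0 := by
    ext j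
    exact hno j (Finset.mem_univ j)
  have h1 := h.l2norm_mulVec k
  rw [h0, Matrix.mulVec_zero, l2norm_zero] at h1
  exact (Real.sqrt_pos.2 (Nat.cast_pos.2 (h.pos_left k))).ne h1

/-- The singular values and vectors computed in the first step are close to the true ones, the
singular vectors up to a common sign. -/
theorem IsFirstStep.error_bounds (h : IsLatentFactorDecomposition X C U d V) {γ b : ℝ}
    (hγ : 0 < γ) (hd : SingularValueCondition q d γ b) {E : Matrix (Fin n) (Fin q) ℝ} {a : ℝ}
    (hE : ∀ x, ‖E.toEuclideanLin x‖ ≤ a * (√(n : ℝ) * √(q : ℝ)) * ‖x‖)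
    {Z : Matrix (Fin n) (Fin r) ℝ} {d' : Fin r → ℝ} {V' : Matrix (Fin q) (Fin r) ℝ}
    (h' : IsFirstStep (X * C + E) Z d' V') (hr : rstar ≤ r) (k : Fin rstar) :
    (√(q : ℝ))⁻¹ * |(√(n : ℝ))⁻¹ * d' (Fin.castLE hr k) - d k| ≤ a ∧
    ∃ ε : ℝ, (ε = 1 ∨ ε = -1) ∧
      l2norm (ε • Z.col (Fin.castLE hr k) - (√(n : ℝ))⁻¹ • (X *ᵥ U.col k)) ≤ 4 * a / γ ∧
      l2norm (ε • V'.col (Fin.castLE hr k) - V.col k) ≤ 4 * a / γ := by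
  have hn := h.pos_left k
  have hq := h.pos_right k
  have hsn : 0 < √(n : ℝ) := Real.sqrt_pos.2 (Nat.cast_pos.2 hn)
  have hsq : 0 < √(q : ℝ) := Real.sqrt_pos.2 (Nat.cast_pos.2 hq)
  have hT' := h'.isTruncatedSVD hn hq
  set W := (√(n : ℝ))⁻¹ • (X * U) with hW
  set m : Fin rstar → ℝ := fun k => √(n : ℝ) * d k with hm
  have hT := isTruncatedSVD_mul_diagonal_mul_transpose (m := m) h.left_orthonormal
    h.right_orthonormal (fun k => mul_nonneg hsn.le (h.pos k).le)
    (fun i j hij => mul_le_mul_of_nonneg_left (h.antitone hij) hsn.le)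
  have hker := fun x => mul_diagonal_mul_transpose_map_eq_zero (V := V) W m (x := x)
  have hker' : ∀ y, (∀ k, inner ℝ (colVec W k) y = 0) →
      (W * Matrix.diagonal m * Vᵀ).toEuclideanLin.adjoint y = 0 := fun y hy => by
    rw [adjoint_mul_diagonal_mul_transpose]
    exact mul_diagonal_mul_transpose_map_eq_zero V m hy
  rw [← h.mul_eq hn] at hT hker hker'
  set M := (X * C).toEuclideanLin
  set k' := Fin.castLE hr k
  set η := a * (√(n : ℝ) * √(q : ℝ)) with hη
  have hadd : (X * C + E).toEuclideanLin = M + E.toEuclideanLin := map_add _ _ _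
  rw [hadd] at hT'
  have hη0 : 0 ≤ η := by
    have := hE (colVec V k)
    rw [hT.right.1 k, mul_one] at this
    exact (norm_nonneg _).trans this
  have hsv : |d' k' - m k| ≤ η := by
    rw [abs_sub_le_iff, sub_le_iff_le_add', sub_le_iff_le_add']
    constructor
    · refine hT'.le_add_of_norm_sub_le hT (fun x => ?_) k' k rfl
      rw [LinearMap.add_apply, add_sub_cancel_left]
      exact hE x
    · refine hT.le_add_of_norm_sub_le hT' (fun x => ?_) k k' rfl
      rw [LinearMap.add_apply, sub_add_cancel_left, norm_neg]
      exact hE x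
  constructor
  · have h1 : (√(n : ℝ))⁻¹ * d' k' - d k = (√(n : ℝ))⁻¹ * (d' k' - m k) := by
      rw [hm, mul_sub, inv_mul_cancel_left₀ hsn.ne']
    rw [h1, abs_mul, abs_of_pos (inv_pos.2 hsn), inv_mul_le_iff₀ hsq, inv_mul_le_iff₀ hsn]
    linarith
  -- The singular triple of `X * C + E` is an approximate one of `X * C`, with residuals `-E v` and
  -- `-Eᵀ z`. Only the true singular values need a gap.
  · obtain ⟨ε, hε, h1, h2⟩ := hT.exists_sign_norm_sub_le hker hker' k (hT'.left.1 k')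
      (hT'.right.1 k') (t := d' k') (η := η) (g := γ * (√(n : ℝ) * √(q : ℝ))) (by positivity)
      (fun j hj => by
        rw [hm, ← mul_sub, abs_mul, abs_of_pos hsn]
        have := mul_le_mul_of_nonneg_left (hd.le_abs_sub hq h.antitone hj) hsn.le
        linarith)
      (by
        have := mul_le_mul_of_nonneg_left (hd.le_self hq h.pos k) hsn.le
        rw [hm]
        linarith)
      hsv
      (by
        rw [← hT'.map, LinearMap.add_apply, sub_add_cancel_left, norm_neg]
        refine (hE _).trans_eq ?_
        rw [hT'.right.1, mul_one])
      (by
        rw [← hT'.map_adjoint, map_add, LinearMap.add_apply, sub_add_cancel_left, norm_neg]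
        refine (norm_adjoint_le hη0 hE _).trans_eq ?_
        rw [hT'.left.1, mul_one])
    have h3 : 4 * η / (γ * (√(n : ℝ) * √(q : ℝ))) = 4 * a / γ := by
      rw [hη]
      field_simp
    rw [h3] at h1 h2
    exact ⟨ε, hε, h1, h2⟩

/-- The constant of the error bounds, in terms of the constant `a` of the noise level. -/
noncomputable def errorConstant (a b c : ℝ) : ℝ :=
  24 * c + 24 * c * |b| + 24 * a * c * |b| + 6 * a * |b|

set_option maxHeartbeats 1000000 in
/-- The error bounds hold whenever the operator norm of the noise is bounded by
`a √n √q rate`. -/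
theorem IsPEER.error_bounds (h : IsLatentFactorDecomposition X C U d V) {γ b ρ a c σ : ℝ} {s : ℕ}
    (hσ : 0 < σ) (hγ : 0 < γ) (hρ : 0 < ρ) (hX : ColumnsNormalized X)
    (hd : SingularValueCondition q d γ b) (hRE : RestrictedEigenvalue X s ρ)
    (hs : ∀ k, l0norm (U.col k) ≤ s) (ha : 1 ≤ a) (hac : 4 * a ≤ c)
    {E : Matrix (Fin n) (Fin q) ℝ}
    (hE : ∀ x, ‖E.toEuclideanLin x‖ ≤ a * rate n q σ * (√(n : ℝ) * √(q : ℝ)) * ‖x‖)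
    {dhat : Fin r → ℝ} {Uhat : Matrix (Fin p) (Fin r) ℝ} {Vhat : Matrix (Fin q) (Fin r) ℝ}
    (h' : IsPEER X (X * C + E) (fun _ => 4 * c * γ⁻¹ * rate n q σ) dhat Uhat Vhat)
    (hr : rstar ≤ r) (k : Fin rstar) :
    ∃ ε : ℝ, (ε = 1 ∨ ε = -1) ∧
      l2norm (ε • Uhat.col (Fin.castLE hr k) - U.col k) ≤
        errorConstant a b c * ((γ * ρ)⁻¹ * √(l0norm (U.col k) : ℝ) * rate n q σ) ∧
      l2norm (ε • Vhat.col (Fin.castLE hr k) - V.col k) ≤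
        errorConstant a b c * (γ⁻¹ * rate n q σ) ∧
      (√(q : ℝ))⁻¹ * |dhat (Fin.castLE hr k) - d k| ≤ errorConstant a b c * rate n q σ ∧
      (√(q : ℝ))⁻¹ * frobNorm
          (layer (dhat (Fin.castLE hr k)) (Uhat.col (Fin.castLE hr k))
            (Vhat.col (Fin.castLE hr k)) - layer (d k) (U.col k) (V.col k)) ≤
        errorConstant a b c * ((γ * ρ)⁻¹ * √(l0norm (U.col k) : ℝ) * rate n q σ) ∧
      l2norm (X *ᵥ (ε • Uhat.col (Fin.castLE hr k) - U.col k)) / √(n : ℝ) ≤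
        errorConstant a b c * (√(l0norm (U.col k) : ℝ) * rate n q σ / (γ * √ρ)) ∧
      frobNorm (X *
          (layer (dhat (Fin.castLE hr k)) (Uhat.col (Fin.castLE hr k))
            (Vhat.col (Fin.castLE hr k)) - layer (d k) (U.col k) (V.col k))) /
          √((n : ℝ) * q) ≤
        errorConstant a b c * (√(l0norm (U.col k) : ℝ) * rate n q σ / (γ * √ρ)) := by
  obtain ⟨Z, d', hfs, hdh, hlasso⟩ := h'
  have hn := h.pos_left k
  have hq := h.pos_right k
  have hn' : (0 : ℝ) < n := Nat.cast_pos.2 hn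
  have hsn : 0 < √(n : ℝ) := Real.sqrt_pos.2 hn'
  have hsq : 0 < √(q : ℝ) := Real.sqrt_pos.2 (Nat.cast_pos.2 hq)
  have hR : 0 < rate n q σ := rate_pos hn hσ
  obtain ⟨hdd, ε, hε, hz, hv⟩ := hfs.error_bounds h hγ hd hE hr k
  rw [← hdh] at hdd
  have hl := hlasso (Fin.castLE hr k)
  have hZ1 := l2norm_col_eq_one hfs.left_orthonormal (Fin.castLE hr k)
  have hV1 := l2norm_col_eq_one hfs.right_orthonormal (Fin.castLE hr k)
  set û := Uhat.col (Fin.castLE hr k)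
  set v' := Vhat.col (Fin.castLE hr k)
  set z := Z.col (Fin.castLE hr k)
  set u := U.col k
  set v := V.col k
  set D := dhat (Fin.castLE hr k)
  set R := rate n q σ
  have hc0 : 0 < c := by linarith
  have hs0 : 0 < s := (h.l0norm_pos k).trans_le (hs k)
  have hS1 : 1 ≤ √(l0norm u : ℝ) := Real.one_le_sqrt.2 (by exact_mod_cast h.l0norm_pos k)
  obtain ⟨j, -⟩ := Finset.card_pos.1 (h.l0norm_pos k)
  have hρ1 : ρ ≤ 1 := hRE.le_one hX hn hs0 j
  have hlam : 0 < 4 * c * γ⁻¹ * R := by positivity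
  obtain ⟨hpred, hest⟩ := (hl.smul_sign hε).error_bounds hX hn hRE hρ hs0 (hs k) hlam (by
    refine (mul_le_mul_of_nonneg_left hz (by norm_num)).trans ?_
    rw [div_eq_mul_inv]
    have : 0 ≤ γ⁻¹ * R := by positivity
    nlinarith)
  have hl1 := (mul_le_mul_of_nonneg_left (l2norm_le_l1norm û) hlam.le).trans
    (hl.mul_l1norm_le hn hZ1)
  have hXu' := hl.l2norm_mulVec_le hn hZ1 hlam.le
  have hXu : l2norm (X *ᵥ u) = √(n : ℝ) := h.l2norm_mulVec k
  have hdb : d k ≤ b * √(q : ℝ) := hd.bound k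
  -- This makes `R ≤ b (γ⁻¹ R)`, so errors of order `R` fit the rates carrying `γ⁻¹`, at the price
  -- of a factor `b`.
  have hγb : γ ≤ b := le_of_mul_le_mul_right ((hd.le_self hq h.pos k).trans hdb) hsq
  have hb0 : 0 < b := hγ.trans_le hγb
  have hu1 : ρ * l2norm u ≤ 1 := by
    have h1 := hRE.mul_l2norm_sq_le_of_sparse hn (hs k)
    rw [hXu, Real.sq_sqrt hn'.le, mul_assoc, mul_comm (n : ℝ), ← mul_assoc,
      mul_le_iff_le_one_left hn'] at h1
    have h2 : (ρ * l2norm u) ^ 2 ≤ 1 ^ 2 := by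
      calc (ρ * l2norm u) ^ 2 = ρ * (ρ * l2norm u ^ 2) := by ring
        _ ≤ 1 * 1 := mul_le_mul hρ1 h1 (by positivity) zero_le_one
        _ = 1 ^ 2 := by norm_num
    exact (abs_le_of_sq_le_sq' h2 zero_le_one).2
  have hbabs : |b| = b := abs_of_pos hb0
  have hsρ : 0 < √ρ := Real.sqrt_pos.2 hρ
  have hsρ1 : √ρ ≤ 1 := Real.sqrt_le_one.2 hρ1
  set S := √(l0norm u : ℝ)
  set B := (γ * ρ)⁻¹ * S * R with hB
  set B' := S * R / (γ * √ρ) with hB'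
  have hB0 : 0 ≤ B := by positivity
  have hB'0 : 0 ≤ B' := by positivity
  have hxB : γ⁻¹ * R * ρ⁻¹ ≤ B := by
    rw [hB, mul_inv]
    have : 0 ≤ γ⁻¹ * ρ⁻¹ * R := by positivity
    nlinarith
  have hx0 : 0 < γ⁻¹ * R := by positivity
  have hxB' : γ⁻¹ * R ≤ B' := by
    rw [hB', le_div_iff₀ (by positivity)]
    calc γ⁻¹ * R * (γ * √ρ) = √ρ * R := by field_simp
      _ ≤ S * R := mul_le_mul_of_nonneg_right (hsρ1.trans hS1) hR.le
  have hux : γ⁻¹ * R * l2norm u ≤ B := by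
    refine le_trans (mul_le_mul_of_nonneg_left ?_ hx0.le) hxB
    rwa [← one_div, le_div_iff₀ hρ, mul_comm]
  have hxB1 : γ⁻¹ * R ≤ B :=
    (le_mul_of_one_le_right hx0.le ((one_le_inv₀ hρ).2 hρ1)).trans hxB
  have hRx : R ≤ b * (γ⁻¹ * R) := by
    calc R = γ * (γ⁻¹ * R) := by rw [mul_inv_cancel_left₀ hγ.ne']
      _ ≤ b * (γ⁻¹ * R) := mul_le_mul_of_nonneg_right hγb hx0.le
  have hRB : R ≤ b * B := hRx.trans (mul_le_mul_of_nonneg_left hxB1 hb0.le)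
  have hRB' : R ≤ b * B' := hRx.trans (mul_le_mul_of_nonneg_left hxB' hb0.le)
  have hδ : l2norm (ε • û - u) ≤ 24 * c * B := by
    refine hest.trans_eq ?_
    rw [hB]
    field_simp
    ring
  have hP : l2norm (X *ᵥ (ε • û - u)) / √(n : ℝ) ≤ 6 * c * B' := by
    refine hpred.trans_eq ?_
    rw [hB']
    field_simp
    ring
  have hv2 : l2norm (ε • v' - v) ≤ 4 * a * (γ⁻¹ * R) := by
    refine hv.trans_eq ?_
    rw [div_eq_mul_inv]
    ring
  -- If `R ≤ γ`, the triangle inequality suffices: `R ≤ b` multiplies the Lasso error and `R ‖u‖₂ ≤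
  -- b B` follows from `ρ ‖u‖₂ ≤ 1`. If `R > γ`, the penalty level exceeds `1`, whence `‖û‖₂ ≤ ‖û‖₁
  -- ≤ 1`.
  have hû : R * l2norm û ≤ b * B * (24 * c + 1) := by
    have hbB : 0 ≤ b * B := by positivity
    rcases le_or_gt R γ with hRγ | hRγ
    · have h1 : l2norm û ≤ l2norm (ε • û - u) + l2norm u := by
        have h2 := l2norm_add_le (ε • û - u) u
        rw [sub_add_cancel, l2norm_smul] at h2
        have habs : |ε| = 1 := by rcases hε with rfl | rfl <;> norm_num
        rwa [habs, one_mul] at h2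
      have h3 : R * l2norm (ε • û - u) ≤ b * (24 * c * B) :=
        mul_le_mul (hRγ.trans hγb) hδ (l2norm_nonneg _) hb0.le
      have h4 : R * l2norm u ≤ b * B := by
        calc R * l2norm u ≤ b * (γ⁻¹ * R) * l2norm u :=
              mul_le_mul_of_nonneg_right hRx (l2norm_nonneg _)
          _ = b * (γ⁻¹ * R * l2norm u) := by ring
          _ ≤ b * B := mul_le_mul_of_nonneg_left hux hb0.le
      have h5 := mul_le_mul_of_nonneg_left h1 hR.le
      linarith
    · have h1 : 1 ≤ 4 * c * γ⁻¹ * R := by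
        have h2 : 1 ≤ γ⁻¹ * R := by
          rw [inv_mul_eq_div, le_div_iff₀ hγ, one_mul]
          exact hRγ.le
        nlinarith
      have h3 : l2norm û ≤ 1 :=
        (le_mul_of_one_le_left (l2norm_nonneg _) h1).trans hl1
      have h4 := mul_le_mul_of_nonneg_left h3 hR.le
      have h5 : 0 ≤ b * B * c := by positivity
      linarith
  have hdq : (√(q : ℝ))⁻¹ * d k ≤ b := by
    rw [inv_mul_le_iff₀ hsq]
    linarith
  have hdq0 : 0 ≤ (√(q : ℝ))⁻¹ * d k := mul_nonneg (inv_nonneg.2 hsq.le) (h.pos k).le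
  have hcb : 0 ≤ c * b := by positivity
  have hab : 0 ≤ a * b := by positivity
  have hacb : 0 ≤ a * c * b := by positivity
  have hK : 24 * c ≤ errorConstant a b c := by
    rw [errorConstant, hbabs]
    linarith
  have hK4 : a * (b * (24 * c + 1)) + b * (24 * c) + b * (4 * a) ≤ errorConstant a b c := by
    rw [errorConstant, hbabs]
    linarith
  have hK6 : 2 * a * b + b * (6 * c) + b * (4 * a) ≤ errorConstant a b c := by
    rw [errorConstant, hbabs]
    linarith
  refine ⟨ε, hε, ?_, ?_, ?_, ?_, ?_, ?_⟩
  · exact hδ.trans (mul_le_mul_of_nonneg_right hK hB0)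
  · exact hv2.trans (mul_le_mul_of_nonneg_right (by linarith) hx0.le)
  · exact hdd.trans (mul_le_mul_of_nonneg_right (by linarith) hR.le)
  · have h1 := mul_le_mul_of_nonneg_left
      (frobNorm_layer_sub_le (d' := D) (v := v) hε (h.pos k).le u û hV1) (inv_nonneg.2 hsq.le)
    have h2 := mul_le_mul_of_nonneg_right hdd (l2norm_nonneg û)
    have h3 := mul_le_mul hdq hδ (l2norm_nonneg _) hb0.le
    have h4 : (√(q : ℝ))⁻¹ * d k * (l2norm u * l2norm (ε • v' - v)) ≤ b * (4 * a * B) := by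
      refine mul_le_mul hdq ?_ (mul_nonneg (l2norm_nonneg _) (l2norm_nonneg _)) hb0.le
      have h5 := mul_le_mul_of_nonneg_left hv2 (l2norm_nonneg u)
      have h6 := mul_le_mul_of_nonneg_left hux (by linarith : 0 ≤ 4 * a)
      linarith
    have h7 := mul_le_mul_of_nonneg_left hû (by linarith : 0 ≤ a)
    have h8 := mul_le_mul_of_nonneg_right hK4 hB0
    linarith
  · exact hP.trans (mul_le_mul_of_nonneg_right (by linarith) hB'0)
  · rw [Matrix.mul_sub, mul_layer, mul_layer, Real.sqrt_mul hn'.le]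
    have h1 := frobNorm_layer_sub_le (d' := D) (v := v) hε (h.pos k).le (X *ᵥ u) (X *ᵥ û) hV1
    rw [← Matrix.mulVec_smul, ← Matrix.mulVec_sub, hXu] at h1
    rw [div_le_iff₀ hsn] at hP
    rw [inv_mul_le_iff₀ hsq] at hdd
    have hsnq : 0 < √(n : ℝ) * √(q : ℝ) := by positivity
    have hbq : 0 ≤ b * √(q : ℝ) := by positivity
    rw [div_le_iff₀ hsnq]
    have h2 : |D - d k| * l2norm (X *ᵥ û) ≤ √(q : ℝ) * (a * R) * (2 * √(n : ℝ)) :=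
      mul_le_mul hdd hXu' (l2norm_nonneg _) (by positivity)
    have h3 : d k * l2norm (X *ᵥ (ε • û - u)) ≤ b * √(q : ℝ) * (6 * c * B' * √(n : ℝ)) :=
      mul_le_mul hdb hP (l2norm_nonneg _) hbq
    have h4 : d k * √(n : ℝ) * l2norm (ε • v' - v) ≤
        b * √(q : ℝ) * √(n : ℝ) * (4 * a * (γ⁻¹ * R)) :=
      mul_le_mul (mul_le_mul_of_nonneg_right hdb hsn.le) hv2 (l2norm_nonneg _) (by positivity)
    have h5 : 2 * a * R + b * (6 * c * B') + b * (4 * a * (γ⁻¹ * R)) ≤ errorConstant a b c * B' := by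
      have h6 := mul_le_mul_of_nonneg_left hRB' (by linarith : 0 ≤ 2 * a)
      have h7 := mul_le_mul_of_nonneg_left hxB' (by linarith : 0 ≤ 4 * (a * b))
      have h8 := mul_le_mul_of_nonneg_right hK6 hB'0
      linarith
    have h9 := mul_le_mul_of_nonneg_right h5 hsnq.le
    linarith

end Model

end PEER

/-! ### Choice of constants and conclusion. -/

theorem proposition1 (κ : ℝ≥0) (b : ℝ) :
    ∃ c₀ : ℝ, 0 < c₀ ∧ ∀ c : ℝ, c₀ ≤ c → ∃ K : ℝ, 0 < K ∧
    ∀ (n p q r rstar s : ℕ) (σ γ ρ : ℝ)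
      (X : Matrix (Fin n) (Fin p) ℝ) (C : Matrix (Fin p) (Fin q) ℝ)
      (U : Matrix (Fin p) (Fin rstar) ℝ) (d : Fin rstar → ℝ) (V : Matrix (Fin q) (Fin rstar) ℝ)
      (Ω : Type*) [MeasurableSpace Ω] (μ : Measure Ω) [IsProbabilityMeasure μ]
      (E : Fin n → Fin q → Ω → ℝ) (hr : rstar ≤ r),
      0 < σ → 0 < γ → 0 < ρ →
      PEER.ColumnsNormalized X →
      PEER.IsLatentFactorDecomposition X C U d V →
      PEER.ErrorCondition μ E σ κ →
      PEER.SingularValueCondition q d γ b →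
      PEER.RestrictedEigenvalue X s ρ →
      (∀ k, PEER.l0norm (U.col k) ≤ s) →
      ∃ A : Set Ω, MeasurableSet A ∧
        1 - 2 * Real.exp (-(√(n : ℝ) + √(q : ℝ)) ^ 2) ≤ μ.real A ∧
        ∀ ω ∈ A, ∀ (dhat : Fin r → ℝ) (Uhat : Matrix (Fin p) (Fin r) ℝ)
          (Vhat : Matrix (Fin q) (Fin r) ℝ),
          PEER.IsPEER X (X * C + Matrix.of fun i j => E i j ω)
            (fun _ => 4 * c * γ⁻¹ * PEER.rate n q σ) dhat Uhat Vhat →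
          ∀ k : Fin rstar, ∃ ε : ℝ, (ε = 1 ∨ ε = -1) ∧
            PEER.l2norm (ε • Uhat.col (Fin.castLE hr k) - U.col k) ≤
              K * ((γ * ρ)⁻¹ * √(PEER.l0norm (U.col k) : ℝ) * PEER.rate n q σ) ∧
            PEER.l2norm (ε • Vhat.col (Fin.castLE hr k) - V.col k) ≤
              K * (γ⁻¹ * PEER.rate n q σ) ∧
            (√(q : ℝ))⁻¹ * |dhat (Fin.castLE hr k) - d k| ≤ K * PEER.rate n q σ ∧
            (√(q : ℝ))⁻¹ * PEER.frobNorm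
                (PEER.layer (dhat (Fin.castLE hr k)) (Uhat.col (Fin.castLE hr k))
                  (Vhat.col (Fin.castLE hr k)) - PEER.layer (d k) (U.col k) (V.col k)) ≤
              K * ((γ * ρ)⁻¹ * √(PEER.l0norm (U.col k) : ℝ) * PEER.rate n q σ) ∧
            PEER.l2norm (X *ᵥ (ε • Uhat.col (Fin.castLE hr k) - U.col k)) / √(n : ℝ) ≤
              K * (√(PEER.l0norm (U.col k) : ℝ) * PEER.rate n q σ / (γ * √ρ)) ∧
            PEER.frobNorm (X *
                (PEER.layer (dhat (Fin.castLE hr k)) (Uhat.col (Fin.castLE hr k))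
                  (Vhat.col (Fin.castLE hr k)) - PEER.layer (d k) (U.col k) (V.col k))) /
                √((n : ℝ) * q) ≤
              K * (√(PEER.l0norm (U.col k) : ℝ) * PEER.rate n q σ / (γ * √ρ)) := by
  set a : ℝ := 12 * √((κ : ℝ) + 1) with ha
  have ha1 : 1 ≤ a := by
    have : 1 ≤ √((κ : ℝ) + 1) := Real.one_le_sqrt.2 (by linarith [κ.coe_nonneg])
    linarith
  -- The singular vector error is at most `4 a B / γ`, so `c ≥ 4 a` makes the penalty at least four
  -- times this error. The constant involves `|b|` because `K` must be positive for every real `b`.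
  refine ⟨4 * a, by linarith, fun c hc => ⟨PEER.errorConstant a b c, ?_, ?_⟩⟩
  · have hc0 : 0 < c := by linarith
    have ha0 : 0 < a := by linarith
    rw [PEER.errorConstant]
    positivity
  intro n p q r rstar s σ γ ρ X C U d V Ω _ μ _ E hr hσ hγ hρ hX h hE hd hRE hs
  obtain ⟨A, hA, hprob, hop⟩ := hE.exists_event hσ
  refine ⟨A, hA, ?_, fun ω hω dhat Uhat Vhat h' k => ?_⟩
  -- The union bound loses only one exponential, and the claim allows two.
  · linarith [Real.exp_pos (-(√(n : ℝ) + √(q : ℝ)) ^ 2)]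
  · refine PEER.IsPEER.error_bounds h hσ hγ hρ hX hd hRE hs ha1 hc (fun x => ?_) h' hr k
    rw [ha, ← PEER.noiseLevel_eq (h.pos_left k) (h.pos_right k)]
    exact hop ω hω x
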